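/- Let $k,n\ge 1$ be integers with $k>n$ and $\gcd(k,n)=1$. For $\mathbb E\in\{\mathbb R,\mathbb C\}$ let $$\mathcal G^{\mathbb E}_{k,n}=\Big\{\tfrac kn P \;:\; P\in M_k(\mathbb E),\ P=P^*=P^2,\ \operatorname{rank}P=n,\ P_{ii}=\tfrac nk\ (1\le i\le k)\Big\},$$ and let $\mathcal F^{\mathbb E}_{k,n}$ be the set of spherical tight frames of $k$ vectors in $\mathbb E^n$, that is, of all $k$-tuples $(f_1,\dots,f_k)$ of unit vectors of $\mathbb E^n$ for which there is a constant $B>0$ with $\sum_{i=1}^k|\langle v,f_i\rangle|^2=B\|v\|^2$ for all $v\in\mathbb E^n$. Regard $\mathcal F^{\mathbb R}_{k,n}$ as a subset of $(S^{n-1})^k$ and $\mathcal F^{\mathbb C}_{k,n}$ as a subset of $(S^{2n-1})^k$. A subset of a real-analytic manifold is called a regular real-analytic submanifold of dimension $d$ if around each of its points there is a real-analytic chart of the ambient manifold in which the subset is a $d$-dimensional linear slice. Then: (i) $\mathcal G^{\mathbb R}_{k,n}$ is a nonempty regular real-analytic submanifold of $M_k(\mathbb R)$ of dimension $(k-n-1)(n-1)$;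 (ii) $\mathcal F^{\mathbb R}_{k,n}$ is a nonempty regular real-analytic submanifold of $(S^{n-1})^k$ of dimension $(k-\frac n2-1)(n-1)$; (iii) $\mathcal G^{\mathbb C}_{k,n}$ is a nonempty regular real-analytic submanifold of $M_k(\mathbb C)$ (as a real vector space) of dimension $2n(k-n)-k+1$; (iv) $\mathcal F^{\mathbb C}_{k,n}$ is a nonempty regular real-analytic submanifold of $(S^{2n-1})^k$ of dimension $2n(k-n)+n^2-k+1$; (v) for $\mathbb E=\mathbb R$ and for $\mathbb E=\mathbb C$, the point $(\frac nk,\dots,\frac nk)$ is a regular value of the map $P\mapsto(P_{11},\dots,P_{kk})$ from the Grassmannian $\{V^*DV : V\in M_k(\mathbb E),\ V^*V=I\}$, where $D=\operatorname{diag}(1,\dots,1,0,\dots,0)$ with $n$ ones, to the hyperplane $\{d\in\mathbb R^k : \sum_i d_i=n\}$; that is, at each point of the fibre over it the differential maps the tangent space of the Grassmannian onto that of the hyperplane. -/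

import Mathlib

open scoped ContDiff Manifold Matrix Matrix.Norms.Elementwise

noncomputable section

/-! ### Regular real-analytic submanifolds -/

/-- `S` is a regular (i.e. embedded) real-analytic submanifold of dimension `d` of the real-analytic
manifold `M`: around every point of `S` there is a chart `φ` of the maximal real-analytic atlas of
`M` that carries `S` (inside the domain of `φ`) to a `d`-dimensional linear slice of the model
space. -/
def IsRegularAnalyticSubmanifold {E H M : Type*} [NormedAddCommGroup E] [NormedSpace ℝ E]
    [FiniteDimensional ℝ E] [TopologicalSpace H] (I : ModelWithCorners ℝ E H) [I.Boundaryless]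
    [TopologicalSpace M] [ChartedSpace H M] [IsManifold I ω M] (S : Set M) (d : ℕ) : Prop :=
  ∀ p ∈ S, ∃ φ ∈ IsManifold.maximalAtlas I ω M, p ∈ φ.source ∧
    ∃ L : Submodule ℝ E, Module.finrank ℝ L = d ∧
      ∀ x ∈ φ.source, x ∈ S ↔ I (φ x) ∈ L

/-- The case of subsets of a finite-dimensional real normed space, with its standard real-analytic
structure. -/
def IsRegularAnalyticSubmanifoldOfSpace {V : Type*} [NormedAddCommGroup V] [NormedSpace ℝ V]
    [FiniteDimensional ℝ V] (S : Set V) (d : ℕ) : Prop :=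
  IsRegularAnalyticSubmanifold 𝓘(ℝ, V) S d

/-! ### Regular values of maps between submanifolds of normed spaces -/

/-- The vectors tangent to `S` at `p`: velocities at time `0` of real-analytic curves that start at
`p` and stay in `S`. If `S` is a regular real-analytic submanifold of the finite-dimensional space
`V`, this is its tangent space `T_p S`, viewed inside `V`. -/
def tangentVectors {V : Type*} [NormedAddCommGroup V] [NormedSpace ℝ V] (S : Set V) (p : V) :
    Set V :=
  {v | ∃ γ : ℝ → V, AnalyticAt ℝ γ 0 ∧ γ 0 = p ∧ (∀ᶠ t in nhds 0, γ t ∈ S) ∧ HasDerivAt γ v 0}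

/-- `c` is a regular value of the restriction `S → T` of `f : V → W`, where `S ⊆ V` and `T ⊆ W` are
regular real-analytic submanifolds, `f` maps `S` to `T` and `c ∈ T`: at every point `p` of the fibre
the differential `T_p S → T_c T` is onto. -/
def IsRegularValueBetween {V W : Type*} [NormedAddCommGroup V] [NormedSpace ℝ V]
    [NormedAddCommGroup W] [NormedSpace ℝ W] (f : V → W) (S : Set V) (T : Set W) (c : W) : Prop :=
  ∀ p ∈ S, f p = c → ∀ w ∈ tangentVectors T c, ∃ v ∈ tangentVectors S p, fderiv ℝ f p v = w

/-! ### Projections with constant diagonal, and the Grassmannian -/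

/-- `(k/n) P` for the projections (self-adjoint idempotents) `P` in `M_k(𝕜)` of rank `n` all of whose
diagonal entries are `n/k`. -/
def frameGramSet (𝕜 : Type*) [RCLike 𝕜] (k n : ℕ) : Set (Matrix (Fin k) (Fin k) 𝕜) :=
  {R | ∃ P : Matrix (Fin k) (Fin k) 𝕜, P.IsHermitian ∧ P * P = P ∧ P.rank = n ∧
    (∀ i, P i i = (n : 𝕜) / (k : 𝕜)) ∧ R = ((k : 𝕜) / (n : 𝕜)) • P}

/-- The Grassmannian of `n`-planes in `𝕜^k`: the matrices `V* D V` with `V` orthogonal (unitary)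
and `D = diag(1, …, 1, 0, …, 0)` with `n` ones. -/
def grassmannian (𝕜 : Type*) [RCLike 𝕜] (k n : ℕ) : Set (Matrix (Fin k) (Fin k) 𝕜) :=
  {P | ∃ V ∈ Matrix.unitaryGroup (Fin k) 𝕜,
    P = Vᴴ * Matrix.diagonal (fun i : Fin k => if (i : ℕ) < n then (1 : 𝕜) else 0) * V}

/-- The (real parts of the) diagonal entries of a matrix; self-adjoint matrices have real
diagonal. -/
def realDiagonal (𝕜 : Type*) [RCLike 𝕜] (k : ℕ) (P : Matrix (Fin k) (Fin k) 𝕜) : Fin k → ℝ :=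
  fun i => RCLike.re (P i i)

/-- The hyperplane of vectors in `ℝ^k` whose entries add up to `n`. -/
def diagonalHyperplane (k n : ℕ) : Set (Fin k → ℝ) :=
  {d | ∑ i, d i = (n : ℝ)}

/-! ### Spherical tight frames -/

/-- A finite family of vectors is a tight frame: both frame inequalities hold with the same
constant. -/
def IsTightFrame (𝕜 : Type*) [RCLike 𝕜] {X ι : Type*} [NormedAddCommGroup X]
    [InnerProductSpace 𝕜 X] [Fintype ι] (f : ι → X) : Prop :=
  ∃ B : ℝ, 0 < B ∧ ∀ v : X, ∑ i, ‖inner 𝕜 v (f i)‖ ^ 2 = B * ‖v‖ ^ 2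

/-- The spherical tight frames of `k` vectors in `𝕜^n`, as a subset of the `k`-fold product of the
unit sphere. -/
def sphericalTightFrames (𝕜 : Type*) [RCLike 𝕜] (k n : ℕ) :
    Set (Fin k → Metric.sphere (0 : EuclideanSpace 𝕜 (Fin n)) 1) :=
  {F | IsTightFrame 𝕜 (fun i => (F i : EuclideanSpace 𝕜 (Fin n)))}

/-! ### The real-analytic structure of products of spheres

The unit sphere of a real inner product space of dimension `m + 1` is, in Mathlib, a real-analytic
manifold modelled on `EuclideanSpace ℝ (Fin m)`; below `m = n - 1` for `ℝ^n` and `m = 2n - 1` for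
`ℂ^n`, and powers of a manifold carry the product structure. -/

instance fact_finrank_real (n : ℕ) [NeZero n] :
    Fact (Module.finrank ℝ (EuclideanSpace ℝ (Fin n)) = (n - 1) + 1) :=
  ⟨by have := NeZero.ne n; simp; omega⟩

instance fact_finrank_complex (n : ℕ) [NeZero n] :
    Fact (Module.finrank ℝ (EuclideanSpace ℂ (Fin n)) = (2 * n - 1) + 1) :=
  ⟨by
    have := NeZero.ne n
    rw [LinearEquiv.finrank_eq (WithLp.linearEquiv 2 ℝ (Fin n → ℂ)), Module.finrank_pi_fintype]
    simp
    omega⟩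

/-- The model of a `k`-fold product of manifolds modelled on `ℝ^m`. -/
abbrev powerModel (k m : ℕ) :
    ModelWithCorners ℝ (Fin k → EuclideanSpace ℝ (Fin m))
      (ModelPi fun _ : Fin k => EuclideanSpace ℝ (Fin m)) :=
  ModelWithCorners.pi fun _ : Fin k => 𝓘(ℝ, EuclideanSpace ℝ (Fin m))

instance boundaryless_powerModel (k m : ℕ) : (powerModel k m).Boundaryless :=
  ⟨by
    rw [Set.range_eq_univ]
    exact fun x => ⟨x, rfl⟩⟩

instance isManifold_power (k m : ℕ) (M : Type*) [TopologicalSpace M]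
    [ChartedSpace (EuclideanSpace ℝ (Fin m)) M] [IsManifold 𝓘(ℝ, EuclideanSpace ℝ (Fin m)) ω M] :
    IsManifold (powerModel k m) ω (Fin k → M) := by
  apply isManifold_of_contDiffOn
  rintro _ _ ⟨f, hf, rfl⟩ ⟨g, hg, rfl⟩
  rw [contDiffOn_pi]
  intro i
  have h := (contDiffGroupoid ω 𝓘(ℝ, EuclideanSpace ℝ (Fin m))).compatible
    (hf i trivial) (hg i trivial)
  have h2 := h.1
  simp only [contDiffPregroupoid, modelWithCornersSelf_coe, modelWithCornersSelf_coe_symm,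
    Function.comp_id, Function.id_comp, Set.preimage_id, Set.range_id, Set.inter_univ] at h2
  refine h2.comp (t := ((f i).symm.trans (g i)).source)
    (f := fun x : Fin k → EuclideanSpace ℝ (Fin m) => x i) (contDiff_apply _ _ i).contDiffOn ?_
  rintro _ ⟨⟨hx1, hx2⟩, y, rfl⟩
  exact ⟨hx1 i trivial, hx2 i trivial⟩

end

/-! Everything rests on one arithmetic fact, `eq_of_commute_realDiagonalMatrix`. If a real diagonal
matrix `D` commutes with a projection `P` of diagonal `n/k`, then `P` is block diagonal along the
level sets of `D`. A block of size `s` is a projection of trace `s n/k`, which must be an integer;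
coprimality forces `k ∣ s`, so there is one block and `D` is scalar.

By duality this gives submersivity (`exists_skew_realDiagonal_commutator`). For `X = [P, D]`, which
is skew-adjoint, the trace of `D [X, P]` is minus the squared Frobenius norm of `X`. Hence `D ↦ diag
[[P, D], P]` kills only scalars, and its range is all vectors of sum zero. Since `[X, P]` is the
velocity of `exp(tX) P exp(-tX)`, this is the regular value claim.

For the projections, the correction `X ↦ X + P X² P - (1 - P) X² (1 - P)` flattens the idempotency
of `P + X` near `X = 0`: it carries self-adjoint solutions to off-diagonal matrices. Conversely, if
the corrected matrix is off-diagonal, the remaining corner of the defect solves a linear equation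
with small coefficients and vanishes. A further second order correction from the submersivity makes
the diagonal condition linear too (`eventually_isProjection_iff`). The dimension is that of the
off-diagonal self-adjoint matrices minus `k - 1`.

For the frames, with `T` the matrix of columns, tightness means that the traceless part of `T T*`
vanishes. Differentiating along the tangential part `U` of `Z T`, with `Z` traceless self-adjoint,
gives an endomorphism in `Z`. Pairing with `Z` shows that on its kernel `U = 0`, so every frame
vector is an eigenvector of `Z`; the arithmetic fact makes `Z` scalar, hence zero. Thus the
differential is onto.

Nonemptiness comes from the projection onto `n` discrete Fourier characters with symmetric
frequencies, which is real and circulant. -/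

/-! ### Straightening and the regular value theorem in charts -/

section Charts

variable {E H M : Type*} [NormedAddCommGroup E] [NormedSpace ℝ E]
    [FiniteDimensional ℝ E] [TopologicalSpace H] (I : ModelWithCorners ℝ E H) [I.Boundaryless]
    [TopologicalSpace M] [ChartedSpace H M] [IsManifold I ω M]

/-- Composing a chart with an analytic local diffeomorphism of the model space gives a chart. -/
theorem exists_chart_of_hasFDerivAt_equiv {φ₀ : OpenPartialHomeomorph M H}
    (hφ₀ : φ₀ ∈ IsManifold.maximalAtlas I ω M) {p : M} (hp : p ∈ φ₀.source) {f : E → E}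
    (hf : ContDiffAt ℝ ω f (I (φ₀ p))) {f' : E ≃L[ℝ] E}
    (hf' : HasFDerivAt f (f' : E →L[ℝ] E) (I (φ₀ p))) {U : Set M} (hU : U ∈ nhds p) :
    ∃ φ ∈ IsManifold.maximalAtlas I ω M, p ∈ φ.source ∧ φ.source ⊆ U ∧
      ∀ x ∈ φ.source, I (φ x) = f (I (φ₀ x)) := by
  have hω : (ω : WithTop ℕ∞) ≠ 0 := by simp
  have hω' : (ω : WithTop ℕ∞) ≠ ∞ := by simp
  set ψ₀ := hf.toOpenPartialHomeomorph f hf' hω with hψ₀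
  have hψ₀c : (ψ₀ : E → E) = f := rfl
  have hp₀ : I (φ₀ p) ∈ ψ₀.source := hf.mem_toOpenPartialHomeomorph_source hf' hω
  have hsymm : ContDiffAt ℝ ω ψ₀.symm (f (I (φ₀ p))) := hf.to_localInverse hf' hω
  -- The inverse function theorem gives analyticity at the one point only; restricting to the points
  -- where both directions are analytic yields an admissible change of coordinates.
  set ψ := ψ₀.restrContDiff ℝ ω hω' with hψ
  have hψs : ContDiffOn ℝ ω ψ ψ.source := ψ₀.contDiffOn_restrContDiff_source ℝ hω'
  have hψt : ContDiffOn ℝ ω ψ.symm ψ.target := ψ₀.contDiffOn_restrContDiff_target ℝ hω'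
  have hp₁ : I (φ₀ p) ∈ ψ.source := ⟨hp₀, hf, hsymm⟩
  set J := I.toHomeomorph.toOpenPartialHomeomorph with hJ
  set φ₁ : OpenPartialHomeomorph M H := φ₀ ≫ₕ (J ≫ₕ (ψ ≫ₕ J.symm)) with hφ₁
  have h1 : φ₁ ∈ IsManifold.maximalAtlas I ω M := by
    apply OpenPartialHomeomorph.mem_maximalAtlas_of_contMDiffOn
    · have a1 := contMDiffOn_of_mem_maximalAtlas hφ₀
      have a2 : ContMDiffOn 𝓘(ℝ, E) 𝓘(ℝ, E) ω ψ ψ.source := hψs.contMDiffOn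
      have a3 : ContMDiffOn I 𝓘(ℝ, E) ω (fun x => ψ (I (φ₀ x))) φ₁.source := by
        refine a2.comp (t := ψ.source) ((I.contMDiff.comp_contMDiffOn a1).mono ?_) ?_
        · intro x hx; exact hx.1
        · intro x hx
          simp [hφ₁, hJ] at hx
          exact hx.2
      refine (I.contMDiffOn_symm.comp a3 ?_)
      intro x _
      simp [I.range_eq_univ]
    · have a1 := contMDiffOn_symm_of_mem_maximalAtlas hφ₀
      have a2 : ContMDiffOn 𝓘(ℝ, E) 𝓘(ℝ, E) ω ψ.symm ψ.target := hψt.contMDiffOn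
      have a3 : ContMDiffOn I 𝓘(ℝ, E) ω (fun x => ψ.symm (I x)) φ₁.target := by
        refine a2.comp (t := ψ.target) I.contMDiff.contMDiffOn ?_
        intro x hx
        simp [hφ₁, hJ] at hx
        exact hx.1
      have a4 : ContMDiffOn I I ω (fun x => I.symm (ψ.symm (I x))) φ₁.target :=
        I.contMDiffOn_symm.comp a3 (fun x _ => by simp [I.range_eq_univ])
      refine a1.comp a4 ?_
      intro x hx
      simp [hφ₁, hJ] at hx
      exact hx.2
  have hpφ₁ : p ∈ φ₁.source := by simp [hφ₁, hJ, hp, hp₁]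
  refine ⟨φ₁.restr (interior U), restr_mem_maximalAtlas (contDiffGroupoid ω I) h1 isOpen_interior,
    ?_, ?_, ?_⟩
  · rw [OpenPartialHomeomorph.restr_source' _ _ isOpen_interior]
    exact ⟨hpφ₁, mem_interior_iff_mem_nhds.2 hU⟩
  · rw [OpenPartialHomeomorph.restr_source' _ _ isOpen_interior]
    exact fun x hx => interior_subset hx.2
  · intro x _
    exact I.right_inv (by simp [I.range_eq_univ])

/-- A set which in suitable local coordinates is the preimage of a linear subspace under an analytic
map with invertible differential is a submanifold. -/
theorem isRegularAnalyticSubmanifold_of_straightening {S : Set M} {d : ℕ}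
    (h : ∀ p ∈ S, ∃ φ₀ ∈ IsManifold.maximalAtlas I ω M, p ∈ φ₀.source ∧
      ∃ (f : E → E) (f' : E ≃L[ℝ] E) (L : Submodule ℝ E), ContDiffAt ℝ ω f (I (φ₀ p)) ∧
        HasFDerivAt f (f' : E →L[ℝ] E) (I (φ₀ p)) ∧ Module.finrank ℝ L = d ∧
        ∀ᶠ x in nhds p, x ∈ S ↔ f (I (φ₀ x)) ∈ L) :
    IsRegularAnalyticSubmanifold I S d := by
  intro p hp
  obtain ⟨φ₀, hφ₀, hpφ₀, f, f', L, hf, hf', hL, hS⟩ := h p hp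
  obtain ⟨φ, hφ, hpφ, hφU, hφf⟩ := exists_chart_of_hasFDerivAt_equiv I hφ₀ hpφ₀ hf hf' hS
  exact ⟨φ, hφ, hpφ, L, hL, fun x hx => by rw [hφf x hx]; exact hφU hx⟩

/-- The regular value theorem: a set which is locally the zero set of an analytic submersion is a
submanifold. -/
theorem isRegularAnalyticSubmanifold_of_submersion {W : Type*} [NormedAddCommGroup W]
    [NormedSpace ℝ W] [FiniteDimensional ℝ W] {S : Set M} {d : ℕ}
    (hd : Module.finrank ℝ E = d + Module.finrank ℝ W)
    (h : ∀ p ∈ S, ∃ φ₀ ∈ IsManifold.maximalAtlas I ω M, p ∈ φ₀.source ∧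
      ∃ g : E → W, ContDiffAt ℝ ω g (I (φ₀ p)) ∧
        Function.Surjective (fderiv ℝ g (I (φ₀ p))) ∧
        ∀ᶠ x in nhds p, x ∈ S ↔ g (I (φ₀ x)) = 0) :
    IsRegularAnalyticSubmanifold I S d := by
  apply isRegularAnalyticSubmanifold_of_straightening
  intro p hp
  obtain ⟨φ₀, hφ₀, hpφ₀, g, hg, hsurj, hS⟩ := h p hp
  set q := I (φ₀ p) with hq
  set A := fderiv ℝ g q with hA
  obtain ⟨B₀, hB₀⟩ := (A : E →ₗ[ℝ] W).exists_rightInverse_of_surjective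
    (LinearMap.range_eq_top.2 hsurj)
  set B : W →L[ℝ] E := LinearMap.toContinuousLinearMap B₀
  have hAB : ∀ w, A (B w) = w := fun w => LinearMap.congr_fun hB₀ w
  -- Keep the component of `x - q` along `ker A` and replace the complementary one by `B (g x)`. The
  -- derivative at `q` is the identity, and `A` of the new map is `g`, so the zero set of `g`
  -- becomes `ker A`.
  refine ⟨φ₀, hφ₀, hpφ₀, fun x => (x - q) - B (A (x - q)) + B (g x),
    ContinuousLinearEquiv.refl ℝ E, LinearMap.ker (A : E →ₗ[ℝ] W), ?_, ?_, ?_, ?_⟩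
  · have := B.contDiff.contDiffAt.comp q hg
    have h1 : ContDiffAt ℝ ω (fun x => (x - q) - B (A (x - q))) q := by fun_prop
    exact h1.add this
  · have h1 : HasFDerivAt g A q := (hg.differentiableAt (by simp)).hasFDerivAt
    have h2 := B.hasFDerivAt.comp q h1
    have h3 : HasFDerivAt (fun x : E => x - q) (ContinuousLinearMap.id ℝ E) q :=
      (hasFDerivAt_id q).sub_const q
    have h4 := (B.comp A).hasFDerivAt.comp q h3
    refine ((h3.sub h4).add h2).congr_fderiv ?_
    ext x
    simp
  · have := LinearMap.finrank_range_add_finrank_ker (A : E →ₗ[ℝ] W)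
    rw [LinearMap.range_eq_top.2 hsurj, finrank_top] at this
    omega
  · filter_upwards [hS] with x hx
    rw [hx]
    simp [hAB]

end Charts

/-! ### Level sets in powers of the unit sphere -/

section Spheres

variable {V : Type*} [NormedAddCommGroup V] [InnerProductSpace ℝ V]

theorem contDiffAt_coe_chartAt_symm_sphere {m : ℕ} [Fact (Module.finrank ℝ V = m + 1)]
    (p : Metric.sphere (0 : V) 1) :
    ContDiffAt ℝ ω (fun y => ((chartAt (EuclideanSpace ℝ (Fin m)) p).symm y : V))
      (chartAt (EuclideanSpace ℝ (Fin m)) p p) := by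
  rw [← contMDiffAt_iff_contDiffAt]
  have h1 : ContMDiffAt (𝓡 m) 𝓘(ℝ, V) ω ((↑) : Metric.sphere (0 : V) 1 → V)
      ((chartAt (EuclideanSpace ℝ (Fin m)) p).symm (chartAt (EuclideanSpace ℝ (Fin m)) p p)) :=
    contMDiff_coe_sphere.contMDiffAt
  exact h1.comp _ (contMDiffAt_symm_of_mem_maximalAtlas
    (IsManifold.chart_mem_maximalAtlas (I := 𝓡 m) p)
    ((chartAt (EuclideanSpace ℝ (Fin m)) p).map_source (mem_chart_source _ p)))

/-- The differential of the inclusion of the sphere has range the orthogonal complement of `p`. This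
converts ambient tangent vectors into chart coordinates. -/
theorem exists_fderiv_coe_chartAt_symm_sphere_eq {m : ℕ} [Fact (Module.finrank ℝ V = m + 1)]
    (p : Metric.sphere (0 : V) 1) {v : V} (hv : inner ℝ (p : V) v = 0) :
    ∃ u, fderiv ℝ (fun y => ((chartAt (EuclideanSpace ℝ (Fin m)) p).symm y : V))
      (chartAt (EuclideanSpace ℝ (Fin m)) p p) u = v := by
  have h := range_mvfderiv_subtypeVal (n := m) p
  rw [((contMDiff_coe_sphere p).mdifferentiableAt one_ne_zero).mvfderiv] at h
  have hv' : v ∈ (Submodule.span ℝ {(p : V)})ᗮ :=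
    Submodule.mem_orthogonal_singleton_iff_inner_right.2 hv
  rw [← h] at hv'
  obtain ⟨u, hu⟩ := hv'
  refine ⟨u, ?_⟩
  simp only [fderivWithin_univ, mfld_simps] at hu
  exact hu

/-- The regular value theorem for maps on a power of the unit sphere: it suffices that the
differential of the ambient extension is onto when restricted to tuples of tangent vectors. -/
theorem isRegularAnalyticSubmanifold_sphere_pow {m k : ℕ} [Fact (Module.finrank ℝ V = m + 1)]
    {W : Type*} [NormedAddCommGroup W] [NormedSpace ℝ W] [FiniteDimensional ℝ W]
    {S : Set (Fin k → Metric.sphere (0 : V) 1)} {d : ℕ} {G : (Fin k → V) → W}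
    (hG : ContDiff ℝ ω G) (hS : ∀ F, F ∈ S ↔ G (fun i => (F i : V)) = 0)
    (hsurj : ∀ F ∈ S, ∀ w : W, ∃ v : Fin k → V, (∀ i, inner ℝ (F i : V) (v i) = 0) ∧
      fderiv ℝ G (fun i => (F i : V)) v = w)
    (hd : k * m = d + Module.finrank ℝ W) :
    IsRegularAnalyticSubmanifold (powerModel k m) S d := by
  refine isRegularAnalyticSubmanifold_of_submersion (powerModel k m) (W := W) ?_ ?_
  · rw [Module.finrank_pi_fintype]
    simpa using hd
  intro p hp
  refine ⟨chartAt _ p, IsManifold.chart_mem_maximalAtlas p, mem_chart_source _ p,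
    fun y => G (fun i => ((chartAt (EuclideanSpace ℝ (Fin m)) (p i)).symm (y i) : V)), ?_, ?_, ?_⟩
  all_goals
    set q : Fin k → EuclideanSpace ℝ (Fin m) :=
      fun i => chartAt (EuclideanSpace ℝ (Fin m)) (p i) (p i) with hq
    have hqI : powerModel k m (chartAt _ p p) = q := rfl
    have hcd : ∀ i, ContDiffAt ℝ ω
        (fun y => ((chartAt (EuclideanSpace ℝ (Fin m)) (p i)).symm y : V)) (q i) :=
      fun i => contDiffAt_coe_chartAt_symm_sphere (p i)
  · rw [hqI]
    refine hG.contDiffAt.comp q (contDiffAt_pi.2 fun i => ?_)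
    exact ContDiffAt.comp (g := fun y =>
      ((chartAt (EuclideanSpace ℝ (Fin m)) (p i)).symm y : V)) q (hcd i)
      (contDiff_apply ℝ (EuclideanSpace ℝ (Fin m)) i).contDiffAt
  · rw [hqI]
    intro w
    obtain ⟨v, hv, hvw⟩ := hsurj p hp w
    choose u hu using fun i => exists_fderiv_coe_chartAt_symm_sphere_eq (m := m) (p i) (hv i)
    refine ⟨u, ?_⟩
    have hc : HasFDerivAt (fun y : Fin k → EuclideanSpace ℝ (Fin m) =>
        fun i => ((chartAt (EuclideanSpace ℝ (Fin m)) (p i)).symm (y i) : V))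
        (ContinuousLinearMap.pi fun i =>
          (fderiv ℝ (fun y => ((chartAt (EuclideanSpace ℝ (Fin m)) (p i)).symm y : V)) (q i)).comp
            (ContinuousLinearMap.proj i)) q := by
      refine hasFDerivAt_pi.2 fun i => ?_
      have h1 := ((hcd i).differentiableAt (by simp)).hasFDerivAt
      exact h1.comp q (ContinuousLinearMap.proj (R := ℝ)
        (φ := fun _ : Fin k => EuclideanSpace ℝ (Fin m)) i).hasFDerivAt
    have hcp : (fun i => ((chartAt (EuclideanSpace ℝ (Fin m)) (p i)).symm (q i) : V)) =
        fun i => (p i : V) := by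
      funext i
      rw [hq, (chartAt (EuclideanSpace ℝ (Fin m)) (p i)).left_inv (mem_chart_source _ (p i))]
    have hGd := ((hG.differentiable (by simp)) (fun i => (p i : V))).hasFDerivAt
    rw [← hcp] at hGd
    have hfd : HasFDerivAt (fun y : Fin k → EuclideanSpace ℝ (Fin m) =>
        G (fun i => ((chartAt (EuclideanSpace ℝ (Fin m)) (p i)).symm (y i) : V))) _ q :=
      hGd.comp q hc
    rw [hfd.fderiv, hcp]
    rw [← hvw]
    simp only [ContinuousLinearMap.comp_apply]
    congr 1
    funext i
    exact hu i
  · filter_upwards [(chartAt _ p).open_source.mem_nhds (mem_chart_source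
      (ModelPi fun _ : Fin k => EuclideanSpace ℝ (Fin m)) p)] with x hx
    rw [hS]
    have : (fun i => (((chartAt (EuclideanSpace ℝ (Fin m)) (p i)).symm
        (powerModel k m (chartAt (ModelPi fun _ : Fin k => EuclideanSpace ℝ (Fin m)) p x) i)
          : Metric.sphere (0 : V) 1) : V)) = fun i => (x i : V) := by
      have := (chartAt (ModelPi fun _ : Fin k => EuclideanSpace ℝ (Fin m)) p).left_inv hx
      funext i
      exact congrArg Subtype.val (congrFun this i)
    rw [this]

end Spheres

/-! ### Diagonals of commutators with a projection -/

section Projections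

variable {𝕜 : Type*} [RCLike 𝕜] {k n : ℕ}

/-- The source of integrality: an idempotent projects onto its range, so its trace counts a
dimension. -/
theorem trace_eq_rank_of_idempotent {ι K : Type*} [Fintype ι] [DecidableEq ι] [Field K]
    {P : Matrix ι ι K} (hP : P * P = P) : P.trace = P.rank := by
  have h1 : IsIdempotentElem (Matrix.toLin' P) := by
    rw [IsIdempotentElem, Module.End.mul_eq_comp, ← Matrix.toLin'_mul, hP]
  have h2 := (LinearMap.IsIdempotentElem.isProj_range _ h1).trace
  rw [Matrix.trace_toLin'_eq] at h2
  rw [h2, Matrix.rank]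
  rfl

/-- The diagonal matrix with given real entries. -/
noncomputable def realDiagonalMatrix (𝕜 : Type*) [RCLike 𝕜] {k : ℕ} :
    (Fin k → ℝ) →ₗ[ℝ] Matrix (Fin k) (Fin k) 𝕜 where
  toFun z := Matrix.diagonal fun i => (z i : 𝕜)
  map_add' x y := by ext i j; by_cases h : i = j <;> simp [h]
  map_smul' c x := by ext i j; by_cases h : i = j <;> simp [h, RCLike.real_smul_eq_coe_mul]

theorem realDiagonalMatrix_apply (z : Fin k → ℝ) :
    realDiagonalMatrix 𝕜 z = Matrix.diagonal fun i => (z i : 𝕜) := rfl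

theorem conjTranspose_realDiagonalMatrix (z : Fin k → ℝ) :
    (realDiagonalMatrix 𝕜 z)ᴴ = realDiagonalMatrix 𝕜 z := by
  simp [realDiagonalMatrix_apply, Matrix.diagonal_conjTranspose, Pi.star_def]

/-- A projection with constant diagonal `n / k`, where `n` and `k` are coprime, commutes with no
diagonal matrices but the scalar ones. -/
theorem eq_of_commute_realDiagonalMatrix (hcop : Nat.Coprime n k)
    {P : Matrix (Fin k) (Fin k) 𝕜} (hP : P * P = P) (hdiag : ∀ i, P i i = (n : 𝕜) / k)
    {z : Fin k → ℝ} (hz : P * realDiagonalMatrix 𝕜 z = realDiagonalMatrix 𝕜 z * P)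
    (i j : Fin k) : z i = z j := by
  have hk : k ≠ 0 := by rintro rfl; exact i.elim0
  have hoff : ∀ a b, z a ≠ z b → P a b = 0 := by
    intro a b hab
    have h := congrFun (congrFun hz a) b
    rw [realDiagonalMatrix_apply, Matrix.mul_diagonal, Matrix.diagonal_mul] at h
    have h2 : ((z b : 𝕜) - z a) * P a b = 0 := by rw [sub_mul, ← h]; ring
    rcases mul_eq_zero.1 h2 with h3 | h3
    · exact absurd (by exact_mod_cast (sub_eq_zero.1 h3).symm) hab
    · exact h3
  classical
  set J : Finset (Fin k) := Finset.univ.filter fun a => z a = z i with hJ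
  -- The block of `P` on the level set `J`. It is idempotent because `P` has no entries between
  -- different level sets, and its trace is `|J| n / k`.
  set Q : Matrix (Fin k) (Fin k) 𝕜 := Matrix.of fun a b => if z a = z i then P a b else 0 with hQ
  have hQQ : Q * Q = Q := by
    ext a b
    rw [Matrix.mul_apply]
    simp only [hQ, Matrix.of_apply]
    by_cases ha : z a = z i
    · simp only [ha, if_true]
      rw [← congrFun (congrFun hP a) b, Matrix.mul_apply]
      refine Finset.sum_congr rfl fun c _ => ?_
      by_cases hc : z c = z i
      · rw [if_pos hc, ← congrFun (congrFun hP c) b]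
      · rw [hoff a c (by rw [ha]; exact Ne.symm hc)]; simp
    · simp [ha]
  have htr := trace_eq_rank_of_idempotent hQQ
  have htr2 : Q.trace = (J.card : 𝕜) * (n / k) := by
    simp only [Matrix.trace, Matrix.diag, hQ, Matrix.of_apply, hdiag]
    rw [← Finset.sum_filter, Finset.sum_const, nsmul_eq_mul]
  have hk' : (k : 𝕜) ≠ 0 := by exact_mod_cast hk
  have hnat : J.card * n = Q.rank * k := by
    have : (J.card : 𝕜) * n = Q.rank * k := by
      rw [← htr, htr2]; field_simp
    exact_mod_cast this
  have hdvd : k ∣ J.card := by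
    apply Nat.Coprime.dvd_of_dvd_mul_right hcop.symm
    exact ⟨Q.rank, by rw [hnat, mul_comm]⟩
  have hpos : 0 < J.card := Finset.card_pos.2 ⟨i, by simp [hJ]⟩
  have hle : k ≤ J.card := Nat.le_of_dvd hpos hdvd
  have huniv : J = Finset.univ := by
    apply Finset.eq_univ_of_card
    have := Finset.card_le_univ J
    simp at this ⊢
    omega
  have hj : j ∈ J := by rw [huniv]; exact Finset.mem_univ j
  simpa [hJ, eq_comm] using hj

/-- `realDiagonal` as a linear map. -/
def realDiagonalLinear (𝕜 : Type*) [RCLike 𝕜] (k : ℕ) :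
    Matrix (Fin k) (Fin k) 𝕜 →ₗ[ℝ] (Fin k → ℝ) where
  toFun := realDiagonal 𝕜 k
  map_add' A B := by ext i; simp [realDiagonal]
  map_smul' c A := by ext i; simp [realDiagonal, RCLike.smul_re]

theorem realDiagonalLinear_apply (A : Matrix (Fin k) (Fin k) 𝕜) (i : Fin k) :
    realDiagonalLinear 𝕜 k A i = RCLike.re (A i i) := rfl

theorem sum_realDiagonalLinear (A : Matrix (Fin k) (Fin k) 𝕜) :
    ∑ i, realDiagonalLinear 𝕜 k A i = RCLike.re A.trace := by
  simp [realDiagonalLinear_apply, Matrix.trace]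

theorem sum_mul_realDiagonalLinear (z : Fin k → ℝ) (A : Matrix (Fin k) (Fin k) 𝕜) :
    ∑ i, z i * realDiagonalLinear 𝕜 k A i = RCLike.re (realDiagonalMatrix 𝕜 z * A).trace := by
  simp [realDiagonalLinear_apply, Matrix.trace, realDiagonalMatrix_apply, Matrix.diagonal_mul]

theorem re_trace_conjTranspose_mul_self {m : Type*} [Fintype m] {l : Type*} [Fintype l]
    (A : Matrix m l 𝕜) : RCLike.re (Aᴴ * A).trace = ∑ j, ∑ i, ‖A i j‖ ^ 2 := by
  simp only [Matrix.trace, Matrix.diag, Matrix.mul_apply, Matrix.conjTranspose_apply, map_sum]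
  refine Finset.sum_congr rfl fun j _ => Finset.sum_congr rfl fun i _ => ?_
  rw [RCLike.star_def, RCLike.conj_mul]
  norm_cast

/-- The trace is the squared Frobenius norm. Both injectivity arguments below end here. -/
theorem eq_zero_of_re_trace_conjTranspose_mul_self {m : Type*} [Fintype m] {l : Type*} [Fintype l]
    {A : Matrix m l 𝕜} (h : RCLike.re (Aᴴ * A).trace = 0) : A = 0 := by
  rw [re_trace_conjTranspose_mul_self,
    Finset.sum_eq_zero_iff_of_nonneg (fun j _ => by positivity)] at h
  ext i j
  have := (Finset.sum_eq_zero_iff_of_nonneg (fun i _ => by positivity)).1 (h j (Finset.mem_univ j))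
    i (Finset.mem_univ i)
  simpa using this

/-- The commutator with a fixed matrix, as a real linear map. -/
noncomputable def commutatorLinear {k : ℕ} (P : Matrix (Fin k) (Fin k) 𝕜) :
    Matrix (Fin k) (Fin k) 𝕜 →ₗ[ℝ] Matrix (Fin k) (Fin k) 𝕜 :=
  LinearMap.mulLeft ℝ P - LinearMap.mulRight ℝ P

theorem commutatorLinear_apply (P A : Matrix (Fin k) (Fin k) 𝕜) :
    commutatorLinear P A = P * A - A * P := rfl

/-- The diagonals of the commutators of `P` with skew-adjoint matrices exhaust the vectors of sum
zero, when `P` is a projection with constant diagonal `n / k` in lowest terms. -/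
theorem exists_skew_realDiagonal_commutator (hcop : Nat.Coprime n k)
    {P : Matrix (Fin k) (Fin k) 𝕜} (hPH : Pᴴ = P) (hP : P * P = P)
    (hdiag : ∀ i, P i i = (n : 𝕜) / k) :
    ∃ Z : (Fin k → ℝ) →ₗ[ℝ] Matrix (Fin k) (Fin k) 𝕜, (∀ w, (Z w)ᴴ = -Z w) ∧
      ∀ w : Fin k → ℝ, ∑ i, w i = 0 → realDiagonalLinear 𝕜 k (Z w * P - P * Z w) = w := by
  set X : (Fin k → ℝ) →ₗ[ℝ] Matrix (Fin k) (Fin k) 𝕜 :=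
    commutatorLinear P ∘ₗ realDiagonalMatrix 𝕜 with hX
  have hXa : ∀ z, X z = P * realDiagonalMatrix 𝕜 z - realDiagonalMatrix 𝕜 z * P := fun z => rfl
  have hXskew : ∀ z, (X z)ᴴ = -X z := by
    intro z
    rw [hXa, Matrix.conjTranspose_sub, Matrix.conjTranspose_mul, Matrix.conjTranspose_mul,
      conjTranspose_realDiagonalMatrix, hPH, neg_sub]
  set T : (Fin k → ℝ) →ₗ[ℝ] (Fin k → ℝ) :=
    realDiagonalLinear 𝕜 k ∘ₗ (-(commutatorLinear P)) ∘ₗ X with hT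
  have hTa : ∀ z, T z = realDiagonalLinear 𝕜 k (X z * P - P * X z) := by
    intro z
    simp only [hT, LinearMap.comp_apply, LinearMap.neg_apply, commutatorLinear_apply, neg_sub]
  have hTsum : ∀ z, ∑ i, T z i = 0 := by
    intro z
    rw [hTa, sum_realDiagonalLinear, Matrix.trace_sub, Matrix.trace_mul_comm]
    simp
  have hTz : ∀ z, T z = 0 → ∀ i j, z i = z j := by
    intro z hz
    apply eq_of_commute_realDiagonalMatrix hcop hP hdiag
    have h0 : ∑ i, z i * T z i = 0 := by simp [hz]
    rw [hTa, sum_mul_realDiagonalLinear] at h0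
    -- Cyclicity of the trace moves the commutator with `P` onto the diagonal matrix, which
    -- reproduces `X z`; skewness supplies the sign.
    have h1 : (realDiagonalMatrix 𝕜 z * (X z * P - P * X z)).trace =
        -((X z)ᴴ * X z).trace := by
      have key : ∀ D Y : Matrix (Fin k) (Fin k) 𝕜,
          (D * (Y * P - P * Y)).trace = (Y * (P * D - D * P)).trace := by
        intro D Y
        rw [Matrix.mul_sub, Matrix.mul_sub, Matrix.trace_sub, Matrix.trace_sub,
          Matrix.trace_mul_comm D, Matrix.mul_assoc, ← Matrix.mul_assoc D,
          Matrix.trace_mul_comm (D * P)]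
      rw [hXskew, Matrix.neg_mul, Matrix.trace_neg, neg_neg, key, ← hXa]
    rw [h1, map_neg, neg_eq_zero] at h0
    have h2 := eq_zero_of_re_trace_conjTranspose_mul_self h0
    rwa [hXa, sub_eq_zero] at h2
  -- `T` lands in the vectors of sum zero and kills only constants, so adding the sum in every
  -- coordinate makes it invertible. If `(T + N) z = w` has sum zero, summing the coordinates gives
  -- `N z = 0`, and `T z = w`.
  set N : (Fin k → ℝ) →ₗ[ℝ] (Fin k → ℝ) :=
    LinearMap.pi fun _ => ∑ j, LinearMap.proj j with hN
  have hNa : ∀ z i, N z i = ∑ j, z j := by intro z i; simp [hN]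
  have hinj : Function.Injective (T + N) := by
    rw [← LinearMap.ker_eq_bot, LinearMap.ker_eq_bot']
    intro z hz
    have h1 : ∀ i, T z i + ∑ j, z j = 0 := fun i => by
      have := congrFun hz i
      simpa [hNa] using this
    have h2 : ∀ i : Fin k, ∑ j, z j = 0 := by
      intro i
      have h3 := Finset.sum_congr rfl fun i (_ : i ∈ (Finset.univ : Finset (Fin k))) => h1 i
      rw [Finset.sum_add_distrib, hTsum] at h3
      simp at h3
      rcases h3 with h3 | h3
      · subst h3; exact i.elim0
      · exact h3
    have h4 : T z = 0 := by
      ext i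
      have := h1 i
      rw [h2 i, add_zero] at this
      simpa using this
    ext i
    have h5 : ∑ j, z j = k * z i := by
      rw [Finset.sum_congr rfl fun j _ => hTz z h4 j i]; simp
    rw [h2 i] at h5
    have hk : (k : ℝ) ≠ 0 := by
      have := i.pos
      positivity
    simpa [hk] using h5.symm
  let e := LinearEquiv.ofInjectiveEndo (T + N) hinj
  refine ⟨X ∘ₗ (e.symm : (Fin k → ℝ) →ₗ[ℝ] (Fin k → ℝ)), fun w => hXskew _, fun w hw => ?_⟩
  set z := e.symm w with hz
  have h1 : ∀ i, T z i + ∑ j, z j = w i := by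
    intro i
    have : (T + N) z = w := e.apply_symm_apply w
    rw [← this]
    simp [hNa]
  have h2 := Finset.sum_congr rfl fun i (_ : i ∈ (Finset.univ : Finset (Fin k))) => h1 i
  rw [Finset.sum_add_distrib, hTsum, hw] at h2
  simp at h2
  change realDiagonalLinear 𝕜 k (X z * P - P * X z) = w
  rw [← hTa]
  ext i
  have h3 := h1 i
  rcases h2 with h2 | h2
  · subst h2; exact i.elim0
  · rwa [h2, add_zero] at h3

end Projections

/-! ### Idempotency of a perturbed idempotent, corner by corner -/

section RingIdentities

variable {R : Type*} [Ring R] {P X : R}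

theorem sq_eq_of_add_idempotent (hP : P * P = P) (hB : (P + X) * (P + X) = P + X) :
    X * X = X - P * X - X * P := by
  have h : (P + X) * (P + X) = P * P + P * X + X * P + X * X := by noncomm_ring
  rw [h, hP] at hB
  have : X * X = P + P * X + X * P + X * X - P - P * X - X * P := by noncomm_ring
  rw [this, hB]
  abel

/-- Compressing the hypothesis by `P` counts the corner `P X P` twice on one side and once on the
other. -/
theorem compression_eq_zero_of_add_eq (hP : P * P = P) (hX : P * X + X * P = X) :
    P * X * P = 0 := by
  have h : P * (P * X + X * P) * P = P * P * X * P + P * X * (P * P) := by noncomm_ring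
  rw [hX, hP] at h
  simpa using h

theorem cocompression_eq_zero_of_add_eq (hP : P * P = P) (hX : P * X + X * P = X) :
    (1 - P) * X * (1 - P) = 0 := by
  have h : (1 - P) * X * (1 - P) = X - (P * X + X * P) + P * X * P := by noncomm_ring
  rw [h, hX, compression_eq_zero_of_add_eq hP hX]
  simp

/-- The correction of `X` by its second order terms is off-diagonal with respect to `P` if `P + X`
is idempotent. -/
theorem straightened_offDiagonal (hP : P * P = P) (hB : (P + X) * (P + X) = P + X) :
    X + (P * (X * X) * P - (1 - P) * (X * X) * (1 - P)) = P * X * (1 - P) + (1 - P) * X * P := by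
  rw [sq_eq_of_add_idempotent hP hB]
  have h : X + (P * (X - P * X - X * P) * P - (1 - P) * (X - P * X - X * P) * (1 - P)) =
    P * X * (1 - P) + (1 - P) * X * P + (P * X * P - P * P * X * P)
      + (P * X * P - P * X * (P * P)) - (P * P - P) * X * (1 - P) - (1 - P) * X * (P * P - P) := by
    noncomm_ring
  rw [h, hP]
  simp

/-- Conversely, the only obstruction to idempotency of `P + X` is the off-diagonal corner `C` of
its defect, which satisfies a homogeneous linear equation with small coefficients. -/
theorem corner_eq_of_straightened_offDiagonal (hP : P * P = P)
    (hY : P * (X + (P * (X * X) * P - (1 - P) * (X * X) * (1 - P))) +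
      (X + (P * (X * X) * P - (1 - P) * (X * X) * (1 - P))) * P =
        X + (P * (X * X) * P - (1 - P) * (X * X) * (1 - P))) :
    P * ((P + X) * (P + X) - (P + X)) * P = 0 ∧
    (1 - P) * ((P + X) * (P + X) - (P + X)) * (1 - P) = 0 ∧
    P * ((P + X) * (P + X) - (P + X)) * (1 - P) =
      P * ((P + X) * (P + X) - (P + X)) * (1 - P) * X * (1 - P) -
        P * X * (P * ((P + X) * (P + X) - (P + X)) * (1 - P)) := by
  have e1 := compression_eq_zero_of_add_eq hP hY
  have e2 := cocompression_eq_zero_of_add_eq hP hY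
  have hPQ : P * (1 - P) = 0 := by rw [mul_sub, hP]; simp
  have hQP : (1 - P) * P = 0 := by rw [sub_mul, hP]; simp
  have hQQ : (1 - P) * (1 - P) = 1 - P := by rw [sub_mul, hPQ]; simp
  -- The diagonal corners of the defect are, up to sign, those of the corrected `X`.
  have f1 : P * ((P + X) * (P + X) - (P + X)) * P = 0 := by
    rw [← e1]
    calc P * ((P + X) * (P + X) - (P + X)) * P
        = (P * P) * (P * P) + (P * P) * X * P + P * X * (P * P) + P * (X * X) * P - (P * P) * P
          - P * X * P := by noncomm_ring
      _ = P * X * P + (P * P) * (X * X) * (P * P)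
          - (P * (1 - P)) * (X * X) * ((1 - P) * P) := by
          rw [hP, hPQ, hP]; simp only [zero_mul, sub_zero]; abel
      _ = _ := by noncomm_ring
  have f2 : (1 - P) * ((P + X) * (P + X) - (P + X)) * (1 - P) = 0 := by
    rw [← neg_eq_zero, ← e2]
    calc -((1 - P) * ((P + X) * (P + X) - (P + X)) * (1 - P))
        = (1 - P) * X * (1 - P) - (1 - P) * (X * X) * (1 - P)
          - (1 - P) * P * P * (1 - P) - (1 - P) * P * X * (1 - P) - (1 - P) * X * (P * (1 - P))
          + (1 - P) * P * (1 - P) := by noncomm_ring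
      _ = (1 - P) * X * (1 - P) + ((1 - P) * P) * (X * X) * (P * (1 - P))
          - ((1 - P) * (1 - P)) * (X * X) * ((1 - P) * (1 - P)) := by
          rw [hQP, hPQ, hQQ]; simp
      _ = _ := by noncomm_ring
  refine ⟨f1, f2, ?_⟩
  generalize hE : (P + X) * (P + X) - (P + X) = E at f1 f2 ⊢
  -- The defect is a polynomial in `P + X`, hence commutes with it; the off-diagonal corner of this
  -- relation is the desired equation.
  have hcomm : (P + X) * E = E * (P + X) := by rw [← hE]; noncomm_ring
  have g : P * ((P + X) * E) * (1 - P) = P * (E * (P + X)) * (1 - P) := by rw [hcomm]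
  have g1 : P * ((P + X) * E) * (1 - P) = P * P * E * (1 - P) + P * X * (P * E * (1 - P))
      + P * X * ((1 - P) * E * (1 - P)) := by noncomm_ring
  have g2 : P * (E * (P + X)) * (1 - P) = P * E * (P * (1 - P)) + P * E * (1 - P) * X * (1 - P)
      + P * E * P * X * (1 - P) := by noncomm_ring
  rw [g1, g2, hP, hPQ, f1, f2] at g
  simp only [mul_zero, zero_mul, add_zero, zero_add] at g
  rw [← g]
  abel

theorem eq_zero_of_corners (P : R) {E : R} (h1 : P * E * P = 0) (h2 : P * E * (1 - P) = 0)
    (h3 : (1 - P) * E * P = 0) (h4 : (1 - P) * E * (1 - P) = 0) : E = 0 := by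
  have : E = P * E * P + P * E * (1 - P) + (1 - P) * E * P + (1 - P) * E * (1 - P) := by
    noncomm_ring
  rw [this, h1, h2, h3, h4]; simp

end RingIdentities

/-! ### Dimension of the tangent spaces -/

section OffDiagonal

variable {𝕜 : Type*} [RCLike 𝕜] {k n : ℕ}

/-- The self-adjoint matrices that are off-diagonal with respect to the projection `P`: the tangent
space of the Grassmannian at `P`. -/
def offDiagonalSubmodule (P : Matrix (Fin k) (Fin k) 𝕜) :
    Submodule ℝ (Matrix (Fin k) (Fin k) 𝕜) where
  carrier := {Y | Yᴴ = Y ∧ P * Y + Y * P = Y}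
  add_mem' := by
    rintro A B ⟨hA, hA'⟩ ⟨hB, hB'⟩
    refine ⟨by rw [Matrix.conjTranspose_add, hA, hB], ?_⟩
    have : P * (A + B) + (A + B) * P = (P * A + A * P) + (P * B + B * P) := by noncomm_ring
    rw [this, hA', hB']
  zero_mem' := by simp
  smul_mem' := by
    rintro c A ⟨hA, hA'⟩
    refine ⟨by rw [Matrix.conjTranspose_smul, hA]; simp, ?_⟩
    rw [Matrix.mul_smul, Matrix.smul_mul, ← smul_add, hA']

theorem commutator_mem_offDiagonalSubmodule {P Z : Matrix (Fin k) (Fin k) 𝕜} (hPH : Pᴴ = P)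
    (hP : P * P = P) (hZ : Zᴴ = -Z) : Z * P - P * Z ∈ offDiagonalSubmodule P := by
  refine ⟨?_, ?_⟩
  · rw [Matrix.conjTranspose_sub, Matrix.conjTranspose_mul, Matrix.conjTranspose_mul, hPH, hZ]
    noncomm_ring
  · have : P * (Z * P - P * Z) + (Z * P - P * Z) * P = Z * (P * P) - (P * P) * Z := by
      noncomm_ring
    rw [this, hP]

/-- The map `X ↦ P X (1 - P)`. -/
noncomputable def cornerMap (P : Matrix (Fin k) (Fin k) 𝕜) :
    Matrix (Fin k) (Fin k) 𝕜 →ₗ[𝕜] Matrix (Fin k) (Fin k) 𝕜 :=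
  LinearMap.mulLeft 𝕜 P ∘ₗ LinearMap.mulRight 𝕜 (1 - P)

theorem cornerMap_apply (P X : Matrix (Fin k) (Fin k) 𝕜) :
    cornerMap P X = P * (X * (1 - P)) := rfl

/-- The matrix unit at `(i, j)` occurs in its own image with coefficient `P i i * (1 - P) j j`, so
the sum over pairs factors. -/
theorem trace_cornerMap (P : Matrix (Fin k) (Fin k) 𝕜) :
    LinearMap.trace 𝕜 _ (cornerMap P) = P.trace * (1 - P).trace := by
  rw [LinearMap.trace_eq_matrix_trace 𝕜 (Matrix.stdBasis 𝕜 (Fin k) (Fin k)), Matrix.trace,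
    Fintype.sum_prod_type, Matrix.trace, Matrix.trace, Finset.sum_mul_sum]
  refine Finset.sum_congr rfl fun i _ => Finset.sum_congr rfl fun j _ => ?_
  rw [Matrix.diag_apply, LinearMap.toMatrix_apply, Matrix.stdBasis_eq_single, cornerMap_apply,
    ← Matrix.mul_assoc]
  have hrepr : ∀ A : Matrix (Fin k) (Fin k) 𝕜,
      (Matrix.stdBasis 𝕜 (Fin k) (Fin k)).repr A (i, j) = A i j := fun A => rfl
  rw [hrepr, Matrix.mul_apply, Finset.sum_eq_single j]
  · simp [Matrix.mul_single_apply_same]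
  · intro b _ hb
    rw [Matrix.mul_single_apply_of_ne _ _ _ _ _ hb]; simp
  · simp

/-- `cornerMap P` is itself idempotent, so the dimension of its range is its trace. -/
theorem finrank_range_cornerMap {P : Matrix (Fin k) (Fin k) 𝕜} (hP : P * P = P)
    (hrank : P.rank = n) : Module.finrank 𝕜 (LinearMap.range (cornerMap P)) = n * (k - n) := by
  have hQ : (1 - P) * (1 - P) = 1 - P := by
    have : (1 - P) * (1 - P) = 1 - P - P + P * P := by noncomm_ring
    rw [this, hP]; abel
  have hidem : IsIdempotentElem (cornerMap P) := by
    refine LinearMap.ext fun X => ?_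
    rw [Module.End.mul_apply, cornerMap_apply, cornerMap_apply]
    have : P * (P * (X * (1 - P)) * (1 - P)) = (P * P) * X * ((1 - P) * (1 - P)) := by
      noncomm_ring
    rw [this, hP, hQ, Matrix.mul_assoc]
  have h1 := (LinearMap.IsIdempotentElem.isProj_range _ hidem).trace
  rw [trace_cornerMap, Matrix.trace_sub, Matrix.trace_one, trace_eq_rank_of_idempotent hP, hrank,
    Fintype.card_fin] at h1
  have hnk : n ≤ k := by
    rw [← hrank]
    simpa using P.rank_le_card_width
  rw [← Nat.cast_sub hnk] at h1
  exact_mod_cast h1.symm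

/-- An off-diagonal self-adjoint matrix is `B + B*` for a unique `B` in the range of `cornerMap P`;
restricting scalars gives the factor `finrank ℝ 𝕜`. -/
theorem finrank_offDiagonalSubmodule {P : Matrix (Fin k) (Fin k) 𝕜} (hPH : Pᴴ = P)
    (hP : P * P = P) (hrank : P.rank = n) :
    Module.finrank ℝ (offDiagonalSubmodule P) = Module.finrank ℝ 𝕜 * (n * (k - n)) := by
  rw [← finrank_range_cornerMap hP hrank, Module.finrank_mul_finrank]
  have hPQ : P * (1 - P) = 0 := by rw [Matrix.mul_sub, hP]; simp
  have hQP : (1 - P) * P = 0 := by rw [Matrix.sub_mul, hP]; simp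
  have hmem : ∀ B, B ∈ LinearMap.range (cornerMap P) → P * B = B ∧ B * P = 0 := by
    rintro _ ⟨X, rfl⟩
    rw [cornerMap_apply]
    constructor
    · rw [← Matrix.mul_assoc, hP]
    · rw [Matrix.mul_assoc, Matrix.mul_assoc, hQP]; simp
  let e : offDiagonalSubmodule P ≃ₗ[ℝ] LinearMap.range (cornerMap P) :=
    { toFun := fun Y => ⟨cornerMap P Y, LinearMap.mem_range_self _ _⟩
      map_add' := fun A B => by ext1; simp
      map_smul' := fun c A => by
        ext1
        simp [cornerMap_apply]
      invFun := fun B => ⟨B + (B : Matrix (Fin k) (Fin k) 𝕜)ᴴ, by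
        obtain ⟨h1, h2⟩ := hmem B B.2
        have h3 := congrArg Matrix.conjTranspose h1
        have h4 := congrArg Matrix.conjTranspose h2
        rw [Matrix.conjTranspose_mul, hPH] at h3 h4
        rw [Matrix.conjTranspose_zero] at h4
        refine ⟨by simp [add_comm], ?_⟩
        rw [Matrix.mul_add, Matrix.add_mul, h1, h2, h3, h4]; simp⟩
      left_inv := fun Y => by
        obtain ⟨hY1, hY2⟩ := Y.2
        have h0 := compression_eq_zero_of_add_eq hP hY2
        ext1
        have : cornerMap P Y = P * Y := by
          rw [cornerMap_apply, ← Matrix.mul_assoc, Matrix.mul_sub, h0]; simp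
        simp only [this, Matrix.conjTranspose_mul, hPH, hY1, hY2]
      right_inv := fun B => by
        obtain ⟨h1, h2⟩ := hmem B B.2
        have h4 := congrArg Matrix.conjTranspose h2
        rw [Matrix.conjTranspose_mul, hPH, Matrix.conjTranspose_zero] at h4
        ext1
        change cornerMap P (B + (B : Matrix (Fin k) (Fin k) 𝕜)ᴴ) = B
        rw [cornerMap_apply, ← Matrix.mul_assoc, Matrix.mul_add, h1, h4, add_zero, Matrix.mul_sub,
          h2]
        simp }
  exact e.finrank_eq

theorem finrank_ker_sum (hk : k ≠ 0) :
    Module.finrank ℝ (LinearMap.ker (∑ j, LinearMap.proj j : (Fin k → ℝ) →ₗ[ℝ] ℝ)) = k - 1 := by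
  have h := LinearMap.finrank_range_add_finrank_ker
    (∑ j, LinearMap.proj j : (Fin k → ℝ) →ₗ[ℝ] ℝ)
  have hs : LinearMap.range (∑ j, LinearMap.proj j : (Fin k → ℝ) →ₗ[ℝ] ℝ) = ⊤ := by
    rw [LinearMap.range_eq_top]
    intro c
    refine ⟨fun _ => c / k, ?_⟩
    have : (k : ℝ) ≠ 0 := by exact_mod_cast hk
    simp
    field_simp
  rw [hs, finrank_top] at h
  simp only [Module.finrank_self, Module.finrank_fin_fun] at h
  omega

/-- Rank-nullity for the diagonal on the off-diagonal space. Its image lies in the sum-zero vectors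
because off-diagonal matrices have trace zero, and commutators fill that space. -/
theorem finrank_offDiagonal_inf_ker_realDiagonal (hk : k ≠ 0) (hcop : Nat.Coprime n k)
    {P : Matrix (Fin k) (Fin k) 𝕜} (hPH : Pᴴ = P) (hP : P * P = P) (hrank : P.rank = n)
    (hdiag : ∀ i, P i i = (n : 𝕜) / k) :
    Module.finrank ℝ (offDiagonalSubmodule P ⊓ LinearMap.ker (realDiagonalLinear 𝕜 k) :
      Submodule ℝ (Matrix (Fin k) (Fin k) 𝕜)) + (k - 1) =
        Module.finrank ℝ 𝕜 * (n * (k - n)) := by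
  rw [← finrank_offDiagonalSubmodule hPH hP hrank]
  have h := LinearMap.finrank_range_add_finrank_ker
    ((realDiagonalLinear 𝕜 k).domRestrict (offDiagonalSubmodule P))
  have hker : Module.finrank ℝ (LinearMap.ker
      ((realDiagonalLinear 𝕜 k).domRestrict (offDiagonalSubmodule P))) =
      Module.finrank ℝ (offDiagonalSubmodule P ⊓ LinearMap.ker (realDiagonalLinear 𝕜 k) :
        Submodule ℝ (Matrix (Fin k) (Fin k) 𝕜)) := by
    rw [← Submodule.map_comap_subtype, Submodule.finrank_map_subtype_eq]
    rfl
  have hrange : LinearMap.range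
      ((realDiagonalLinear 𝕜 k).domRestrict (offDiagonalSubmodule P)) =
      LinearMap.ker (∑ j, LinearMap.proj j : (Fin k → ℝ) →ₗ[ℝ] ℝ) := by
    obtain ⟨Z, hZ, hZw⟩ := exists_skew_realDiagonal_commutator hcop hPH hP hdiag
    apply le_antisymm
    · rintro _ ⟨Y, rfl⟩
      have h0 := sum_realDiagonalLinear (Y : Matrix (Fin k) (Fin k) 𝕜)
      have h1 : (Y : Matrix (Fin k) (Fin k) 𝕜).trace = 0 := by
        rw [← Y.2.2, Matrix.trace_add]
        have h2 := compression_eq_zero_of_add_eq hP Y.2.2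
        have h3 : (P * (Y : Matrix (Fin k) (Fin k) 𝕜)).trace = 0 := by
          have h4 : P * (P * (Y : Matrix (Fin k) (Fin k) 𝕜)) = P * Y := by
            rw [← Matrix.mul_assoc, hP]
          rw [← h4, Matrix.trace_mul_comm, h2, Matrix.trace_zero]
        rw [Matrix.trace_mul_comm _ P, h3]
        simp
      rw [h1] at h0
      simpa using h0
    · intro w hw
      have hw' : ∑ i, w i = 0 := by simpa using hw
      exact ⟨⟨Z w * P - P * Z w, commutator_mem_offDiagonalSubmodule hPH hP (hZ w)⟩, hZw w hw'⟩
  rw [hrange, finrank_ker_sum hk, hker] at h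
  rw [← h, add_comm]

end OffDiagonal

/-! ### Calculus of matrix products -/

section MatrixCalculus

variable {𝕜 : Type*} [RCLike 𝕜]

/-- The elementwise norm is not submultiplicative, so products are treated entry by entry. -/
theorem contDiff_matrix_mul {E : Type*} [NormedAddCommGroup E] [NormedSpace ℝ E]
    {l m o : Type*} [Fintype l] [Fintype m] [Fintype o] {r : WithTop ℕ∞}
    {f : E → Matrix l m 𝕜} {g : E → Matrix m o 𝕜} (hf : ContDiff ℝ r f) (hg : ContDiff ℝ r g) :
    ContDiff ℝ r fun x => f x * g x := by
  refine contDiff_pi.2 fun i => contDiff_pi.2 fun j => ?_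
  simp only [Matrix.mul_apply]
  refine ContDiff.sum fun a _ => ?_
  exact ((contDiff_pi.1 (contDiff_pi.1 hf i)) a).mul ((contDiff_pi.1 (contDiff_pi.1 hg a)) j)

theorem hasFDerivAt_matrix_mul {E : Type*} [NormedAddCommGroup E] [NormedSpace ℝ E]
    {l m o : Type*} [Fintype l] [Fintype m] [Fintype o]
    {f : E → Matrix l m 𝕜} {g : E → Matrix m o 𝕜} {f' : E →L[ℝ] Matrix l m 𝕜}
    {g' : E →L[ℝ] Matrix m o 𝕜} {F : E →L[ℝ] Matrix l o 𝕜} {x : E} (hf : HasFDerivAt f f' x)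
    (hg : HasFDerivAt g g' x) (hF : ∀ v, F v = f' v * g x + f x * g' v) :
    HasFDerivAt (fun x => f x * g x) F x := by
  refine hasFDerivAt_pi'.2 fun i => hasFDerivAt_pi'.2 fun j => ?_
  have hf1 := fun a => hasFDerivAt_pi'.1 (hasFDerivAt_pi'.1 hf i) a
  have hg1 := fun a => hasFDerivAt_pi'.1 (hasFDerivAt_pi'.1 hg a) j
  have h := HasFDerivAt.fun_sum (u := Finset.univ) fun a _ => (hf1 a).mul (hg1 a)
  simp only [Matrix.mul_apply]
  refine h.congr_fderiv ?_
  ext v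
  have := congrFun (congrFun (hF v) i) j
  rw [Matrix.add_apply, Matrix.mul_apply, Matrix.mul_apply, ← Finset.sum_add_distrib] at this
  simp only [sum_apply]
  refine Eq.trans ?_ this.symm
  refine Finset.sum_congr rfl fun a _ => ?_
  simp [mul_comm, add_comm]
  rfl

/-- The self-adjoint part of a matrix. -/
noncomputable def hermitianPart {ι : Type*} : Matrix ι ι 𝕜 →ₗ[ℝ] Matrix ι ι 𝕜 where
  toFun A := (2⁻¹ : ℝ) • (A + Aᴴ)
  map_add' A B := by rw [Matrix.conjTranspose_add, ← smul_add]; congr 1; abel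
  map_smul' c A := by
    rw [Matrix.conjTranspose_smul, star_trivial, ← smul_add, smul_comm, RingHom.id_apply]

theorem hermitianPart_apply {ι : Type*} (A : Matrix ι ι 𝕜) :
    hermitianPart A = (2⁻¹ : ℝ) • (A + Aᴴ) := rfl

theorem conjTranspose_hermitianPart {ι : Type*} (A : Matrix ι ι 𝕜) :
    (hermitianPart A)ᴴ = hermitianPart A := by
  rw [hermitianPart_apply, Matrix.conjTranspose_smul, star_trivial, Matrix.conjTranspose_add,
    Matrix.conjTranspose_conjTranspose, add_comm]

theorem hermitianPart_eq_self {ι : Type*} {A : Matrix ι ι 𝕜} (hA : Aᴴ = A) :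
    hermitianPart A = A := by
  rw [hermitianPart_apply, hA, ← two_smul ℝ A, smul_smul]; simp

section OperatorNorm

attribute [-instance] Matrix.seminormedAddCommGroup Matrix.normedAddCommGroup Matrix.normedSpace

attribute [local instance] Matrix.linftyOpNormedRing Matrix.linftyOpNormedAlgebra

/-- For small `X` the map `C ↦ C X Q - P X C` has norm below one, so its only fixed point is zero.
The estimate uses a submultiplicative norm. -/
theorem eventually_eq_zero_of_eq_sub_mul {k : ℕ} (P Q : Matrix (Fin k) (Fin k) 𝕜) :
    ∀ᶠ X in nhds (0 : Matrix (Fin k) (Fin k) 𝕜),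
      ∀ C : Matrix (Fin k) (Fin k) 𝕜, C = C * X * Q - P * X * C → C = 0 := by
  have hcont : Continuous fun X : Matrix (Fin k) (Fin k) 𝕜 => ‖X‖ * ‖Q‖ + ‖P‖ * ‖X‖ := by fun_prop
  have h0 : ∀ᶠ X in nhds (0 : Matrix (Fin k) (Fin k) 𝕜), ‖X‖ * ‖Q‖ + ‖P‖ * ‖X‖ < 1 := by
    refine hcont.continuousAt.eventually_lt continuousAt_const ?_
    simp
  filter_upwards [h0] with X hX C hC
  by_contra hne
  have hpos : 0 < ‖C‖ := norm_pos_iff.2 hne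
  have h1 : ‖C‖ ≤ ‖C‖ * (‖X‖ * ‖Q‖ + ‖P‖ * ‖X‖) := by
    calc ‖C‖ = ‖C * X * Q - P * X * C‖ := by rw [← hC]
      _ ≤ ‖C * X * Q‖ + ‖P * X * C‖ := norm_sub_le _ _
      _ ≤ ‖C‖ * ‖X‖ * ‖Q‖ + ‖P‖ * ‖X‖ * ‖C‖ := by
          gcongr
          · exact (norm_mul_le _ _).trans (by gcongr; exact norm_mul_le _ _)
          · exact (norm_mul_le _ _).trans (by gcongr; exact norm_mul_le _ _)
      _ = _ := by ring
  nlinarith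

end OperatorNorm

end MatrixCalculus

/-! ### Local linearization of the projections with constant diagonal -/

section Projections

variable {𝕜 : Type*} [RCLike 𝕜] {k n : ℕ}

/-- Subtracting the mean. -/
noncomputable def centering (k : ℕ) : (Fin k → ℝ) →ₗ[ℝ] (Fin k → ℝ) :=
  LinearMap.id - LinearMap.pi fun _ => (k : ℝ)⁻¹ • ∑ j, LinearMap.proj j

theorem centering_apply (w : Fin k → ℝ) (i : Fin k) :
    centering k w i = w i - (k : ℝ)⁻¹ * ∑ j, w j := by
  simp [centering]

theorem sum_centering (w : Fin k → ℝ) : ∑ i, centering k w i = 0 := by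
  rcases eq_or_ne k 0 with rfl | hk
  · simp
  · have : (k : ℝ) ≠ 0 := by exact_mod_cast hk
    simp [centering_apply, this]

theorem conjTranspose_sandwich {A B : Matrix (Fin k) (Fin k) 𝕜} (hA : Aᴴ = A) (hB : Bᴴ = B) :
    (A * B * A)ᴴ = A * B * A := by
  rw [Matrix.conjTranspose_mul, Matrix.conjTranspose_mul, hA, hB, Matrix.mul_assoc]

/-- The map `S ↦ P S P - (1 - P) S (1 - P)`. -/
noncomputable def cornerDifference (P : Matrix (Fin k) (Fin k) 𝕜) :
    Matrix (Fin k) (Fin k) 𝕜 →ₗ[ℝ] Matrix (Fin k) (Fin k) 𝕜 :=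
  LinearMap.mulRight ℝ P ∘ₗ LinearMap.mulLeft ℝ P -
    LinearMap.mulRight ℝ (1 - P) ∘ₗ LinearMap.mulLeft ℝ (1 - P)

theorem cornerDifference_apply (P S : Matrix (Fin k) (Fin k) 𝕜) :
    cornerDifference P S = P * S * P - (1 - P) * S * (1 - P) := rfl

/-- Near a projection `P` of rank `n` with constant diagonal, the projections of the same kind are
cut out by linear conditions after a second order correction. -/
theorem eventually_isProjection_iff (hk : k ≠ 0) {P : Matrix (Fin k) (Fin k) 𝕜} (hPH : Pᴴ = P)
    (hP : P * P = P) (hrank : P.rank = n) (hdiag : ∀ i, P i i = (n : 𝕜) / k)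
    {R : (Fin k → ℝ) →ₗ[ℝ] Matrix (Fin k) (Fin k) 𝕜} (hR : ∀ w, R w ∈ offDiagonalSubmodule P)
    (hRd : ∀ w, realDiagonalLinear 𝕜 k (R w) = centering k w) :
    ∀ᶠ X in nhds (0 : Matrix (Fin k) (Fin k) 𝕜),
      ((P + X).IsHermitian ∧ (P + X) * (P + X) = P + X ∧ (P + X).rank = n ∧
        ∀ i, (P + X) i i = (n : 𝕜) / k) ↔
      X + (cornerDifference P (hermitianPart X * hermitianPart X) - R (realDiagonalLinear 𝕜 k
        (cornerDifference P (hermitianPart X * hermitianPart X)))) ∈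
        offDiagonalSubmodule P ⊓ LinearMap.ker (realDiagonalLinear 𝕜 k) := by
  have hQH : (1 - P)ᴴ = 1 - P := by
    rw [Matrix.conjTranspose_sub, Matrix.conjTranspose_one, hPH]
  have hk' : (k : ℝ) ≠ 0 := by exact_mod_cast hk
  -- Ranks are integers equal to traces, so a trace change below one preserves the rank.
  have htr : ∀ᶠ X in nhds (0 : Matrix (Fin k) (Fin k) 𝕜), |RCLike.re X.trace| < 1 := by
    have hc : Continuous fun X : Matrix (Fin k) (Fin k) 𝕜 => |RCLike.re X.trace| := by fun_prop
    refine hc.continuousAt.eventually_lt continuousAt_const ?_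
    simp
  filter_upwards [eventually_eq_zero_of_eq_sub_mul P (1 - P), htr] with X hsmall hXtr
  set q := cornerDifference P (hermitianPart X * hermitianPart X) with hq
  -- Using the self-adjoint part of `X` in the quadratic term makes `q` self-adjoint for every `X`;
  -- so `X + q` is self-adjoint exactly when `X` is.
  have hqH : qᴴ = q := by
    have hh : (hermitianPart X * hermitianPart X)ᴴ = hermitianPart X * hermitianPart X := by
      rw [Matrix.conjTranspose_mul, conjTranspose_hermitianPart]
    rw [hq, cornerDifference_apply, Matrix.conjTranspose_sub, conjTranspose_sandwich hPH hh,
      conjTranspose_sandwich hQH hh]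
  have hsplit : X + (q - R (realDiagonalLinear 𝕜 k q)) ∈ offDiagonalSubmodule P ↔
      X + q ∈ offDiagonalSubmodule P := by
    rw [← add_sub_assoc]
    exact Submodule.sub_mem_iff_left _ (hR _)
  -- `R` reaches only diagonals of sum zero, so the diagonal condition now reads: the diagonal of
  -- `X` plus the mean of that of `q` vanishes. The mean is removed below by a trace argument in
  -- each direction.
  rw [Submodule.mem_inf, hsplit, LinearMap.mem_ker, map_add, map_sub, hRd]
  constructor
  · rintro ⟨hH, hB, -, hd⟩
    have hXH : Xᴴ = X := by
      have := hH.eq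
      rw [Matrix.conjTranspose_add, hPH] at this
      exact add_left_cancel this
    have hhX : hermitianPart X = X := hermitianPart_eq_self hXH
    rw [hhX, cornerDifference_apply] at hq
    have hXq := straightened_offDiagonal hP hB
    rw [← hq] at hXq
    have hmem : P * (X + q) + (X + q) * P = X + q := by
      rw [hXq]
      have : P * (P * X * (1 - P) + (1 - P) * X * P) + (P * X * (1 - P) + (1 - P) * X * P) * P =
          P * P * X * (1 - P) + (1 - P) * X * (P * P) - (P * P - P) * X * P
            - P * X * (P * P - P) := by noncomm_ring
      rw [this, hP]; simp
    have hrX : realDiagonalLinear 𝕜 k X = 0 := by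
      ext i
      have := hd i
      rw [Matrix.add_apply, hdiag] at this
      rw [realDiagonalLinear_apply, add_eq_left.1 this]
      simp
    have htrX : X.trace = 0 := by
      rw [Matrix.trace]
      refine Finset.sum_eq_zero fun i _ => ?_
      have := hd i
      rw [Matrix.add_apply, hdiag] at this
      exact add_eq_left.1 this
    have htrXq : (X + q).trace = 0 := by
      rw [hXq, Matrix.trace_add, Matrix.mul_assoc, Matrix.trace_mul_comm, Matrix.mul_assoc,
        Matrix.mul_assoc, Matrix.trace_mul_comm (1 - P)]
      have e1 : X * ((1 - P) * P) = X * (P - P * P) := by noncomm_ring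
      have e2 : X * P * (1 - P) = X * (P - P * P) := by noncomm_ring
      rw [e1, e2, hP]; simp
    rw [Matrix.trace_add, htrX, zero_add] at htrXq
    refine ⟨⟨by rw [Matrix.conjTranspose_add, hXH, hqH], hmem⟩, ?_⟩
    rw [hrX, zero_add]
    ext i
    rw [Pi.sub_apply, centering_apply, sum_realDiagonalLinear, htrXq]
    simp
  · rintro ⟨⟨hH, hoff⟩, hd⟩
    have hXH : Xᴴ = X := by
      rw [Matrix.conjTranspose_add, hqH] at hH
      exact add_right_cancel hH
    have hhX : hermitianPart X = X := hermitianPart_eq_self hXH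
    rw [hhX, cornerDifference_apply] at hq
    rw [hq] at hoff
    obtain ⟨e1, e2, e3⟩ := corner_eq_of_straightened_offDiagonal hP hoff
    have hBH : (P + X)ᴴ = P + X := by rw [Matrix.conjTranspose_add, hPH, hXH]
    have e4 := hsmall _ e3
    have e5 := congrArg Matrix.conjTranspose e4
    rw [Matrix.conjTranspose_mul, Matrix.conjTranspose_mul, hQH, hPH,
      Matrix.conjTranspose_sub, Matrix.conjTranspose_mul, hBH, Matrix.conjTranspose_zero,
      ← Matrix.mul_assoc] at e5
    have hB : (P + X) * (P + X) = P + X := sub_eq_zero.1 (eq_zero_of_corners P e1 e4 e5 e2)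
    have htr1 := trace_eq_rank_of_idempotent hB
    have htr2 := trace_eq_rank_of_idempotent hP
    rw [Matrix.trace_add, htr2, hrank] at htr1
    have htr3 : (n : ℝ) + RCLike.re X.trace = (P + X).rank := by
      have := congrArg RCLike.re htr1
      simpa using this
    have hr : (P + X).rank = n := by
      rw [abs_lt] at hXtr
      have h1 : ((P + X).rank : ℝ) < n + 1 := by linarith
      have h2 : (n : ℝ) < (P + X).rank + 1 := by linarith
      have h1' : (P + X).rank < n + 1 := by exact_mod_cast h1
      have h2' : n < (P + X).rank + 1 := by exact_mod_cast h2
      omega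
    rw [hr] at htr3
    have hXtr0 : RCLike.re X.trace = 0 := by linarith
    have hrX : ∀ i, RCLike.re (X i i) + (k : ℝ)⁻¹ * RCLike.re q.trace = 0 := by
      intro i
      have := congrFun hd i
      rw [Pi.add_apply, Pi.sub_apply, centering_apply, sum_realDiagonalLinear,
        realDiagonalLinear_apply] at this
      simpa using this
    have hmean : RCLike.re q.trace = 0 := by
      have h1 : ∑ i, (RCLike.re (X i i) + (k : ℝ)⁻¹ * RCLike.re q.trace) = 0 :=
        Finset.sum_eq_zero fun i _ => hrX i
      rw [Finset.sum_add_distrib] at h1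
      have h2 : ∑ i, RCLike.re (X i i) = RCLike.re X.trace := by simp [Matrix.trace]
      rw [h2, hXtr0] at h1
      simpa [hk'] using h1
    refine ⟨hBH, hB, hr, fun i => ?_⟩
    have h1 := hrX i
    rw [hmean, mul_zero, add_zero] at h1
    have h2 : star (X i i) = X i i := congrFun (congrFun hXH i) i
    have h3 := RCLike.conj_eq_iff_re.1 h2
    rw [Matrix.add_apply, hdiag, ← h3, h1]
    simp

/-- The set of normalized Gram matrices is a submanifold of the space of all matrices. -/
theorem isRegularAnalyticSubmanifold_frameGramSet [NeZero n] (hkn : n < k)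
    (hcop : Nat.Coprime n k) {d : ℕ}
    (hd : d + (k - 1) = Module.finrank ℝ 𝕜 * (n * (k - n))) :
    IsRegularAnalyticSubmanifoldOfSpace (frameGramSet 𝕜 k n) d := by
  have hk : k ≠ 0 := by omega
  have hn : n ≠ 0 := NeZero.ne n
  have hkR : (k : ℝ) ≠ 0 := by exact_mod_cast hk
  have hnR : (n : ℝ) ≠ 0 := by exact_mod_cast hn
  refine isRegularAnalyticSubmanifold_of_straightening _ ?_
  rintro p ⟨P, hPH, hP, hrank, hdiag, hp⟩
  have hcp : ((n : ℝ) / k) • p = P := by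
    rw [hp]
    ext i j
    have h1 : (k : 𝕜) ≠ 0 := by exact_mod_cast hk
    have h2 : (n : 𝕜) ≠ 0 := by exact_mod_cast hn
    simp [RCLike.real_smul_eq_coe_mul]
    field_simp
  obtain ⟨Z, hZ, hZw⟩ := exists_skew_realDiagonal_commutator hcop hPH.eq hP hdiag
  -- A linear choice of off-diagonal matrices with prescribed diagonal, up to the mean.
  set R : (Fin k → ℝ) →ₗ[ℝ] Matrix (Fin k) (Fin k) 𝕜 :=
    (-(commutatorLinear P)) ∘ₗ Z ∘ₗ centering k with hR
  have hRa : ∀ w, R w = Z (centering k w) * P - P * Z (centering k w) := by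
    intro w
    simp only [hR, LinearMap.comp_apply, LinearMap.neg_apply, commutatorLinear_apply, neg_sub]
  have hRo : ∀ w, R w ∈ offDiagonalSubmodule P := fun w => by
    rw [hRa]; exact commutator_mem_offDiagonalSubmodule hPH.eq hP (hZ _)
  have hRd : ∀ w, realDiagonalLinear 𝕜 k (R w) = centering k w := fun w => by
    rw [hRa]; exact hZw _ (sum_centering w)
  set X : Matrix (Fin k) (Fin k) 𝕜 → Matrix (Fin k) (Fin k) 𝕜 := fun A => ((n : ℝ) / k) • A - P
    with hX
  set ℓ : Matrix (Fin k) (Fin k) 𝕜 →L[ℝ] Matrix (Fin k) (Fin k) 𝕜 := LinearMap.toContinuousLinearMap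
    (cornerDifference P - R ∘ₗ realDiagonalLinear 𝕜 k ∘ₗ cornerDifference P) with hℓ
  set η : Matrix (Fin k) (Fin k) 𝕜 →L[ℝ] Matrix (Fin k) (Fin k) 𝕜 :=
    LinearMap.toContinuousLinearMap hermitianPart with hη
  have hc0 : (n : ℝ) / k ≠ 0 := div_ne_zero hnR hkR
  have hXp : X p = 0 := by rw [hX]; simp only [hcp, sub_self]
  have hXcd : ContDiff ℝ ω X := (contDiff_id.const_smul _).sub contDiff_const
  have hXd : HasFDerivAt X (((n : ℝ) / k) • ContinuousLinearMap.id ℝ _) p :=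
    (((n : ℝ) / k) • ContinuousLinearMap.id ℝ (Matrix (Fin k) (Fin k) 𝕜)).hasFDerivAt.sub_const P
  refine ⟨OpenPartialHomeomorph.refl _, (contDiffGroupoid ω 𝓘(ℝ, _)).id_mem_maximalAtlas, trivial,
    fun A => X A + ℓ (η (X A) * η (X A)),
    ContinuousLinearEquiv.smulLeft (Units.mk0 _ hc0),
    offDiagonalSubmodule P ⊓ LinearMap.ker (realDiagonalLinear 𝕜 k), ?_, ?_, ?_, ?_⟩
  · have h1 : ContDiff ℝ ω fun A => η (X A) := η.contDiff.comp hXcd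
    exact (hXcd.add (ℓ.contDiff.comp (contDiff_matrix_mul h1 h1))).contDiffAt
  · have h1 : HasFDerivAt (fun A => η (X A)) _ p := η.hasFDerivAt.comp p hXd
    -- The correction is quadratic in `X A`, which vanishes at `p`; only the scaling by `n / k`
    -- survives in the derivative.
    have h2 : HasFDerivAt (fun A => η (X A) * η (X A))
        (0 : Matrix (Fin k) (Fin k) 𝕜 →L[ℝ] Matrix (Fin k) (Fin k) 𝕜) p := by
      refine hasFDerivAt_matrix_mul h1 h1 fun v => ?_
      rw [hXp]
      simp
      rfl
    refine (hXd.add (ℓ.hasFDerivAt.comp p h2)).congr_fderiv ?_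
    refine ContinuousLinearMap.ext fun v => ?_
    change ((n : ℝ) / k) • v + ℓ 0 = ((n : ℝ) / k) • v
    rw [map_zero, add_zero]
  · have := finrank_offDiagonal_inf_ker_realDiagonal hk hcop hPH.eq hP hrank hdiag
    omega
  · have hev := eventually_isProjection_iff hk hPH.eq hP hrank hdiag hRo hRd
    have htend : Filter.Tendsto X (nhds p) (nhds 0) := by
      rw [← hXp]; exact hXcd.continuous.continuousAt
    filter_upwards [htend.eventually hev] with A hA
    have hPX : P + X A = ((n : ℝ) / k) • A := by simp [hX]
    rw [hPX] at hA
    refine Iff.trans ?_ hA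
    constructor
    · rintro ⟨B, hB1, hB2, hB3, hB4, rfl⟩
      have : ((n : ℝ) / k) • ((k : 𝕜) / n) • B = B := by
        ext i j
        have h1 : (k : 𝕜) ≠ 0 := by exact_mod_cast hk
        have h2 : (n : 𝕜) ≠ 0 := by exact_mod_cast hn
        simp [RCLike.real_smul_eq_coe_mul]
        field_simp
      rw [this]
      exact ⟨hB1, hB2, hB3, hB4⟩
    · rintro ⟨hB1, hB2, hB3, hB4⟩
      refine ⟨_, hB1, hB2, hB3, hB4, ?_⟩
      ext i j
      have h1 : (k : 𝕜) ≠ 0 := by exact_mod_cast hk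
      have h2 : (n : 𝕜) ≠ 0 := by exact_mod_cast hn
      simp [RCLike.real_smul_eq_coe_mul]
      field_simp

end Projections

/-! ### Traceless self-adjoint matrices -/

section TracelessHermitian

variable {𝕜 : Type*} [RCLike 𝕜] {n : ℕ}

/-- The real vector space of self-adjoint matrices. -/
def hermitianSubmodule (𝕜 : Type*) [RCLike 𝕜] (n : ℕ) :
    Submodule ℝ (Matrix (Fin n) (Fin n) 𝕜) where
  carrier := {A | Aᴴ = A}
  add_mem' := by
    intro A B hA hB
    simp only [Set.mem_ofPred_eq] at *
    rw [Matrix.conjTranspose_add, hA, hB]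
  zero_mem' := by simp
  smul_mem' := by
    intro c A hA
    simp only [Set.mem_ofPred_eq] at *
    rw [Matrix.conjTranspose_smul, hA]; simp

theorem mem_hermitianSubmodule {A : Matrix (Fin n) (Fin n) 𝕜} :
    A ∈ hermitianSubmodule 𝕜 n ↔ Aᴴ = A := Iff.rfl

/-- The real part of the trace. -/
noncomputable def reTrace (𝕜 : Type*) [RCLike 𝕜] (n : ℕ) :
    Matrix (Fin n) (Fin n) 𝕜 →ₗ[ℝ] ℝ where
  toFun A := RCLike.re A.trace
  map_add' A B := by simp
  map_smul' c A := by simp [Matrix.trace_smul, RCLike.smul_re]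

theorem reTrace_apply (A : Matrix (Fin n) (Fin n) 𝕜) : reTrace 𝕜 n A = RCLike.re A.trace := rfl

/-- The real vector space of self-adjoint matrices of trace zero. -/
noncomputable def tracelessHermitian (𝕜 : Type*) [RCLike 𝕜] (n : ℕ) :
    Submodule ℝ (Matrix (Fin n) (Fin n) 𝕜) :=
  hermitianSubmodule 𝕜 n ⊓ LinearMap.ker (reTrace 𝕜 n)

theorem reTrace_one : reTrace 𝕜 n 1 = n := by
  simp [reTrace_apply]

theorem finrank_tracelessHermitian [NeZero n] :
    Module.finrank ℝ (tracelessHermitian 𝕜 n) + 1 =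
      Module.finrank ℝ (hermitianSubmodule 𝕜 n) := by
  have h := LinearMap.finrank_range_add_finrank_ker
    ((reTrace 𝕜 n).domRestrict (hermitianSubmodule 𝕜 n))
  have hs : LinearMap.range ((reTrace 𝕜 n).domRestrict (hermitianSubmodule 𝕜 n)) = ⊤ := by
    rw [LinearMap.range_eq_top]
    intro c
    have hn : (n : ℝ) ≠ 0 := by exact_mod_cast NeZero.ne n
    refine ⟨⟨(c / n) • 1, Submodule.smul_mem _ _ (by simp [mem_hermitianSubmodule])⟩, ?_⟩
    rw [LinearMap.domRestrict_apply, map_smul, reTrace_one]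
    simp [hn]
  have hker : Module.finrank ℝ (LinearMap.ker
      ((reTrace 𝕜 n).domRestrict (hermitianSubmodule 𝕜 n))) =
      Module.finrank ℝ (tracelessHermitian 𝕜 n) := by
    rw [tracelessHermitian, ← Submodule.map_comap_subtype, Submodule.finrank_map_subtype_eq]
    rfl
  rw [hs, finrank_top, Module.finrank_self, hker] at h
  omega

/-- A real symmetric matrix is a function on unordered pairs of indices. -/
theorem finrank_hermitianSubmodule_real :
    2 * Module.finrank ℝ (hermitianSubmodule ℝ n) = n * (n + 1) := by
  let e : hermitianSubmodule ℝ n ≃ₗ[ℝ] (Sym2 (Fin n) → ℝ) :=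
    { toFun := fun A => Sym2.lift ⟨fun i j => (A : Matrix (Fin n) (Fin n) ℝ) i j, fun i j => by
        have := congrFun (congrFun A.2 i) j
        simpa using this.symm⟩
      map_add' := fun A B => by
        funext s
        induction s using Sym2.ind
        simp
      map_smul' := fun c A => by
        funext s
        induction s using Sym2.ind
        simp
      invFun := fun g => ⟨Matrix.of fun i j => g s(i, j), by
        ext i j
        simp [Matrix.conjTranspose_apply, Sym2.eq_swap]⟩
      left_inv := fun A => by ext i j; simp
      right_inv := fun g => by
        funext s
        induction s using Sym2.ind
        simp }
  rw [e.finrank_eq, Module.finrank_fintype_fun_eq_card, Sym2.card, Fintype.card_fin,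
    Nat.choose_two_right, Nat.mul_div_cancel' (Nat.even_mul_pred_self _).two_dvd]
  simp [mul_comm]

/-- Every complex matrix is uniquely `B + i C` with `B` and `C` self-adjoint, so the dimension is
half of `2 n²`. -/
theorem finrank_hermitianSubmodule_complex :
    Module.finrank ℝ (hermitianSubmodule ℂ n) = n * n := by
  let e : Matrix (Fin n) (Fin n) ℂ ≃ₗ[ℝ] hermitianSubmodule ℂ n × hermitianSubmodule ℂ n :=
    { toFun := fun A => (⟨hermitianPart A, conjTranspose_hermitianPart A⟩,
        ⟨hermitianPart (-Complex.I • A), conjTranspose_hermitianPart _⟩)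
      map_add' := fun A B => by ext1 <;> ext1 <;> simp
      map_smul' := fun c A => by
        ext1 <;> ext1
        · simp
        · simp [smul_comm (-Complex.I) c A]
      invFun := fun B => (B.1 : Matrix (Fin n) (Fin n) ℂ) + Complex.I • (B.2 : Matrix _ _ ℂ)
      left_inv := fun A => by
        ext i j
        apply Complex.ext <;>
          simp [hermitianPart_apply, Matrix.conjTranspose_apply, Complex.real_smul] <;> ring
      right_inv := fun B => by
        have h1 := fun i j => congrFun (congrFun B.1.2 i) j
        have h2 := fun i j => congrFun (congrFun B.2.2 i) j
        simp only [Matrix.conjTranspose_apply] at h1 h2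
        have h1r := fun i j => congrArg Complex.re (h1 i j)
        have h1i := fun i j => congrArg Complex.im (h1 i j)
        have h2r := fun i j => congrArg Complex.re (h2 i j)
        have h2i := fun i j => congrArg Complex.im (h2 i j)
        simp at h1r h1i h2r h2i
        ext i j
        · apply Complex.ext
          · simp [hermitianPart_apply, Matrix.conjTranspose_apply, Complex.real_smul]
            linarith [h1r i j, h2i i j]
          · simp [hermitianPart_apply, Matrix.conjTranspose_apply, Complex.real_smul]
            linarith [h1i i j, h2r i j]
        · apply Complex.ext
          · simp [hermitianPart_apply, Matrix.conjTranspose_apply, Complex.real_smul]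
            linarith [h2r i j, h1i i j]
          · simp [hermitianPart_apply, Matrix.conjTranspose_apply, Complex.real_smul]
            linarith [h2i i j, h1r i j] }
  have h := e.finrank_eq
  rw [Module.finrank_prod, Module.finrank_matrix] at h
  simp at h
  omega

/-- The projection onto the self-adjoint matrices of trace zero. -/
noncomputable def tracelessPart (𝕜 : Type*) [RCLike 𝕜] (n : ℕ) [NeZero n] :
    Matrix (Fin n) (Fin n) 𝕜 →ₗ[ℝ] tracelessHermitian 𝕜 n :=
  LinearMap.codRestrict (tracelessHermitian 𝕜 n)
    (hermitianPart - (LinearMap.toSpanSingleton ℝ _ (1 : Matrix (Fin n) (Fin n) 𝕜)) ∘ₗ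
      ((n : ℝ)⁻¹ • reTrace 𝕜 n)) (by
    intro A
    have hn : (n : ℝ) ≠ 0 := by exact_mod_cast NeZero.ne n
    simp only [LinearMap.sub_apply, LinearMap.comp_apply, LinearMap.toSpanSingleton_apply,
      LinearMap.smul_apply]
    constructor
    · refine Submodule.sub_mem _ (conjTranspose_hermitianPart A) ?_
      exact Submodule.smul_mem _ _ (by simp [mem_hermitianSubmodule])
    · change reTrace 𝕜 n _ = 0
      rw [map_sub, map_smul, reTrace_one, smul_eq_mul, smul_eq_mul, mul_comm _ (n : ℝ),
        mul_inv_cancel_left₀ hn, sub_eq_zero]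
      simp only [reTrace_apply, hermitianPart_apply, Matrix.trace_smul, Matrix.trace_add,
        Matrix.trace_conjTranspose, RCLike.smul_re, map_add, RCLike.star_def, RCLike.conj_re]
      ring)

theorem coe_tracelessPart [NeZero n] {A : Matrix (Fin n) (Fin n) 𝕜} (hA : Aᴴ = A) :
    (tracelessPart 𝕜 n A : Matrix (Fin n) (Fin n) 𝕜) =
      A - ((n : ℝ)⁻¹ * RCLike.re A.trace) • 1 := by
  change hermitianPart A - ((n : ℝ)⁻¹ • reTrace 𝕜 n A) • (1 : Matrix (Fin n) (Fin n) 𝕜) = _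
  rw [hermitianPart_eq_self hA]
  rfl

end TracelessHermitian

/-! ### Spherical tight frames as a regular level set -/

section Frames

variable {𝕜 : Type*} [RCLike 𝕜] {k n : ℕ}

/-- The matrix whose columns are the given vectors. -/
def columnMatrix (𝕜 : Type*) [RCLike 𝕜] (k n : ℕ) :
    (Fin k → EuclideanSpace 𝕜 (Fin n)) →ₗ[ℝ] Matrix (Fin n) (Fin k) 𝕜 where
  toFun F := Matrix.of fun a i => F i a
  map_add' F G := by ext a i; simp
  map_smul' c F := by ext a i; simp

theorem columnMatrix_apply (F : Fin k → EuclideanSpace 𝕜 (Fin n)) (a : Fin n) (i : Fin k) :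
    columnMatrix 𝕜 k n F a i = F i a := rfl

theorem columnMatrix_surjective : Function.Surjective (columnMatrix 𝕜 k n) := fun T =>
  ⟨fun i => WithLp.toLp 2 fun a => T a i, rfl⟩

theorem conjTranspose_mul_columnMatrix_apply (F G : Fin k → EuclideanSpace 𝕜 (Fin n))
    (i j : Fin k) :
    ((columnMatrix 𝕜 k n F)ᴴ * columnMatrix 𝕜 k n G) i j = inner 𝕜 (F i) (G j) := by
  rw [Matrix.mul_apply, PiLp.inner_apply]
  refine Finset.sum_congr rfl fun a _ => ?_
  rw [Matrix.conjTranspose_apply, columnMatrix_apply, columnMatrix_apply, RCLike.inner_apply,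
    mul_comm, RCLike.star_def]

theorem trace_columnMatrix_mul_conjTranspose {F : Fin k → EuclideanSpace 𝕜 (Fin n)}
    (hF : ∀ i, ‖F i‖ = 1) : (columnMatrix 𝕜 k n F * (columnMatrix 𝕜 k n F)ᴴ).trace = k := by
  rw [Matrix.trace_mul_comm, Matrix.trace]
  simp [conjTranspose_mul_columnMatrix_apply, inner_self_eq_norm_sq_to_K, hF]

theorem sum_norm_inner_sq_eq (F : Fin k → EuclideanSpace 𝕜 (Fin n))
    (v : EuclideanSpace 𝕜 (Fin n)) :
    ((∑ i, ‖inner 𝕜 v (F i)‖ ^ 2 : ℝ) : 𝕜) =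
      inner 𝕜 v (Matrix.toEuclideanLin (columnMatrix 𝕜 k n F * (columnMatrix 𝕜 k n F)ᴴ) v) := by
  have h1 : Matrix.toEuclideanLin (columnMatrix 𝕜 k n F * (columnMatrix 𝕜 k n F)ᴴ) v =
      ∑ i, inner 𝕜 (F i) v • F i := by
    ext a
    simp only [Matrix.toLpLin_apply, ← Matrix.mulVec_mulVec, WithLp.ofLp_sum, Finset.sum_apply,
      WithLp.ofLp_smul, Pi.smul_apply, smul_eq_mul]
    rw [Matrix.mulVec, dotProduct]
    refine Finset.sum_congr rfl fun i _ => ?_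
    rw [columnMatrix_apply, mul_comm]
    congr 1
    rw [Matrix.mulVec, dotProduct, PiLp.inner_apply]
    refine Finset.sum_congr rfl fun b _ => ?_
    rw [Matrix.conjTranspose_apply, columnMatrix_apply, RCLike.inner_apply, mul_comm,
      RCLike.star_def]
  rw [h1, inner_sum]
  push_cast
  refine Finset.sum_congr rfl fun i _ => ?_
  rw [inner_smul_right, ← inner_conj_symm (F i) v, RCLike.conj_mul]

/-- The frame sum is the quadratic form of `T T*`, and a self-adjoint operator is determined by its
quadratic form. -/
theorem columnMatrix_mul_conjTranspose_eq_smul_iff (F : Fin k → EuclideanSpace 𝕜 (Fin n))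
    (B : ℝ) : (∀ v, ∑ i, ‖inner 𝕜 v (F i)‖ ^ 2 = B * ‖v‖ ^ 2) ↔
      columnMatrix 𝕜 k n F * (columnMatrix 𝕜 k n F)ᴴ = B • (1 : Matrix (Fin n) (Fin n) 𝕜) := by
  set A := columnMatrix 𝕜 k n F * (columnMatrix 𝕜 k n F)ᴴ with hA
  have hAH : (A - B • (1 : Matrix (Fin n) (Fin n) 𝕜)).IsHermitian := by
    rw [Matrix.IsHermitian, hA, Matrix.conjTranspose_sub, Matrix.conjTranspose_smul]
    simp
  have hone : ∀ v, Matrix.toEuclideanLin (A - B • (1 : Matrix (Fin n) (Fin n) 𝕜)) v =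
      Matrix.toEuclideanLin A v - (B : 𝕜) • v := by
    intro v
    ext a
    simp [Matrix.toLpLin_apply, Matrix.smul_mulVec, RCLike.real_smul_eq_coe_mul]
  have hsymm := Matrix.isSymmetric_toEuclideanLin_iff.2 hAH
  rw [← sub_eq_zero (a := A), ← LinearEquiv.map_eq_zero_iff Matrix.toEuclideanLin,
    ← hsymm.inner_map_self_eq_zero]
  refine forall_congr' fun v => ?_
  rw [hsymm v v, hone, inner_sub_right, ← sum_norm_inner_sq_eq, inner_smul_right,
    inner_self_eq_norm_sq_to_K, sub_eq_zero]
  norm_cast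

/-- Unit vectors form a tight frame if and only if the traceless part of the frame operator
vanishes. -/
theorem isTightFrame_iff_tracelessPart_eq_zero [NeZero n] (hk : k ≠ 0)
    {F : Fin k → EuclideanSpace 𝕜 (Fin n)} (hF : ∀ i, ‖F i‖ = 1) :
    IsTightFrame 𝕜 F ↔
      tracelessPart 𝕜 n (columnMatrix 𝕜 k n F * (columnMatrix 𝕜 k n F)ᴴ) = 0 := by
  have hn : (n : ℝ) ≠ 0 := by exact_mod_cast NeZero.ne n
  have hAH : (columnMatrix 𝕜 k n F * (columnMatrix 𝕜 k n F)ᴴ)ᴴ =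
      columnMatrix 𝕜 k n F * (columnMatrix 𝕜 k n F)ᴴ := by simp
  have hcoe := coe_tracelessPart hAH
  rw [trace_columnMatrix_mul_conjTranspose hF] at hcoe
  rw [← Submodule.coe_eq_zero, hcoe, sub_eq_zero, ← columnMatrix_mul_conjTranspose_eq_smul_iff]
  constructor
  · rintro ⟨B, -, hB⟩
    have h1 := (columnMatrix_mul_conjTranspose_eq_smul_iff F B).1 hB
    have h2 := congrArg (fun A => RCLike.re A.trace) h1
    simp only [trace_columnMatrix_mul_conjTranspose hF, Matrix.trace_smul, Matrix.trace_one,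
      RCLike.smul_re, Fintype.card_fin, RCLike.natCast_re] at h2
    have : (n : ℝ)⁻¹ * RCLike.re (k : 𝕜) = B := by
      rw [RCLike.natCast_re, h2]; field_simp
    rwa [this]
  · intro h
    refine ⟨_, ?_, h⟩
    rw [RCLike.natCast_re]
    have := Nat.pos_of_ne_zero hk
    have := Nat.pos_of_ne_zero (NeZero.ne n)
    positivity

/-- The trace of `T T*` is `k` for unit vectors, which fixes the frame constant. -/
theorem columnMatrix_mul_conjTranspose_of_isTightFrame [NeZero n]
    {F : Fin k → EuclideanSpace 𝕜 (Fin n)} (hF : ∀ i, ‖F i‖ = 1) (h : IsTightFrame 𝕜 F) :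
    columnMatrix 𝕜 k n F * (columnMatrix 𝕜 k n F)ᴴ =
      ((k : ℝ) / n) • (1 : Matrix (Fin n) (Fin n) 𝕜) := by
  have hn : (n : ℝ) ≠ 0 := by exact_mod_cast NeZero.ne n
  obtain ⟨B, -, hB⟩ := h
  have h1 := (columnMatrix_mul_conjTranspose_eq_smul_iff F B).1 hB
  have h2 := congrArg (fun A => RCLike.re A.trace) h1
  simp only [trace_columnMatrix_mul_conjTranspose hF, Matrix.trace_smul, Matrix.trace_one,
    RCLike.smul_re, Fintype.card_fin, RCLike.natCast_re] at h2
  rw [h1, h2]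
  congr 1
  field_simp

/-- The traceless part of the frame operator. -/
noncomputable def frameDefect (𝕜 : Type*) [RCLike 𝕜] (k n : ℕ) [NeZero n]
    (F : Fin k → EuclideanSpace 𝕜 (Fin n)) : tracelessHermitian 𝕜 n :=
  tracelessPart 𝕜 n (columnMatrix 𝕜 k n F * (columnMatrix 𝕜 k n F)ᴴ)

/-- The conjugate transpose as a real linear map. -/
def conjTransposeReal (𝕜 : Type*) [RCLike 𝕜] (k n : ℕ) :
    Matrix (Fin n) (Fin k) 𝕜 →ₗ[ℝ] Matrix (Fin k) (Fin n) 𝕜 where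
  toFun A := Aᴴ
  map_add' := Matrix.conjTranspose_add
  map_smul' c A := by simp

theorem contDiff_columnMatrix : ContDiff ℝ ω (columnMatrix 𝕜 k n) :=
  (LinearMap.toContinuousLinearMap (columnMatrix 𝕜 k n)).contDiff

theorem contDiff_frameDefect [NeZero n] : ContDiff ℝ ω (frameDefect 𝕜 k n) := by
  refine (LinearMap.toContinuousLinearMap (tracelessPart 𝕜 n)).contDiff.comp
    (contDiff_matrix_mul contDiff_columnMatrix ?_)
  exact (LinearMap.toContinuousLinearMap (conjTransposeReal 𝕜 k n)).contDiff.comp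
    contDiff_columnMatrix

theorem fderiv_frameDefect [NeZero n] (F v : Fin k → EuclideanSpace 𝕜 (Fin n)) :
    fderiv ℝ (frameDefect 𝕜 k n) F v =
      tracelessPart 𝕜 n (columnMatrix 𝕜 k n v * (columnMatrix 𝕜 k n F)ᴴ +
        columnMatrix 𝕜 k n F * (columnMatrix 𝕜 k n v)ᴴ) := by
  set c := LinearMap.toContinuousLinearMap (columnMatrix 𝕜 k n)
  set t := LinearMap.toContinuousLinearMap (conjTransposeReal 𝕜 k n)
  set F' : (Fin k → EuclideanSpace 𝕜 (Fin n)) →L[ℝ] Matrix (Fin n) (Fin n) 𝕜 :=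
    LinearMap.toContinuousLinearMap
    { toFun := fun v => columnMatrix 𝕜 k n v * (columnMatrix 𝕜 k n F)ᴴ +
        columnMatrix 𝕜 k n F * (columnMatrix 𝕜 k n v)ᴴ
      map_add' := fun v w => by
        rw [map_add, Matrix.add_mul, Matrix.conjTranspose_add, Matrix.mul_add]; abel
      map_smul' := fun a v => by
        rw [map_smul, Matrix.conjTranspose_smul, Matrix.smul_mul, Matrix.mul_smul, star_trivial,
          smul_add, RingHom.id_apply] }
  have h1 : HasFDerivAt (fun F => c F * t (c F)) F' F :=
    hasFDerivAt_matrix_mul c.hasFDerivAt (t.hasFDerivAt.comp F c.hasFDerivAt) fun v => rfl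
  have h2 := (LinearMap.toContinuousLinearMap (tracelessPart 𝕜 n)).hasFDerivAt.comp F h1
  have h3 : HasFDerivAt (frameDefect 𝕜 k n) _ F := h2
  rw [h3.fderiv]
  rfl

/-- Pairing the scalar matrix with the traceless `Z` gives zero. The pairing is also twice the
squared norm of `U`, since tangency kills the contribution of the diagonal term. -/
theorem eq_zero_of_tangent_of_mul_conjTranspose_eq_smul {T U : Matrix (Fin n) (Fin k) 𝕜}
    {Z : Matrix (Fin n) (Fin n) 𝕜} (hZH : Zᴴ = Z) (hZt : RCLike.re Z.trace = 0) {z : Fin k → ℝ}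
    (hU : U = Z * T - T * realDiagonalMatrix 𝕜 z) (htan : realDiagonalLinear 𝕜 k (Tᴴ * U) = 0)
    {c : ℝ} (h0 : U * Tᴴ + T * Uᴴ = c • (1 : Matrix (Fin n) (Fin n) 𝕜)) : U = 0 := by
  have h1 : RCLike.re (Z * (U * Tᴴ + T * Uᴴ)).trace = 0 := by
    rw [h0, Matrix.mul_smul, Matrix.mul_one, Matrix.trace_smul, RCLike.smul_re, hZt, mul_zero]
  have h2 : RCLike.re (Z * (T * Uᴴ)).trace =
      RCLike.re (Z * (U * Tᴴ)).trace := by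
    rw [← RCLike.conj_re, ← RCLike.star_def, ← Matrix.trace_conjTranspose,
      Matrix.conjTranspose_mul, Matrix.conjTranspose_mul, Matrix.conjTranspose_conjTranspose, hZH,
      Matrix.trace_mul_comm]
  rw [Matrix.mul_add, Matrix.trace_add, map_add, h2] at h1
  have h3 : RCLike.re (Z * (U * Tᴴ)).trace =
      RCLike.re (Uᴴ * U).trace := by
    have e1 : Tᴴ * Z =
        Uᴴ + realDiagonalMatrix 𝕜 z * Tᴴ := by
      rw [hU, Matrix.conjTranspose_sub, Matrix.conjTranspose_mul, Matrix.conjTranspose_mul, hZH,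
        conjTranspose_realDiagonalMatrix]
      abel
    rw [← Matrix.mul_assoc, Matrix.trace_mul_comm, ← Matrix.mul_assoc, e1, Matrix.add_mul,
      Matrix.trace_add, map_add, Matrix.mul_assoc, ← sum_mul_realDiagonalLinear, htan]
    simp
  rw [h3] at h1
  exact eq_zero_of_re_trace_conjTranspose_mul_self (by linarith)

/-- A self-adjoint matrix of trace zero having all the vectors of a spherical tight frame as
eigenvectors vanishes. -/
theorem eq_zero_of_mul_eq_mul_diagonal [NeZero n] (hk : k ≠ 0) (hcop : Nat.Coprime n k)
    {T : Matrix (Fin n) (Fin k) 𝕜}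
    (hTT : T * Tᴴ = ((k : ℝ) / n) • (1 : Matrix (Fin n) (Fin n) 𝕜))
    (hdiagT : ∀ i, (Tᴴ * T) i i = 1) {Z : Matrix (Fin n) (Fin n) 𝕜} (hZH : Zᴴ = Z)
    (hZt : RCLike.re Z.trace = 0) {z : Fin k → ℝ} (hZT : Z * T = T * realDiagonalMatrix 𝕜 z) :
    Z = 0 := by
  have hn : (n : ℝ) ≠ 0 := by exact_mod_cast NeZero.ne n
  have hkR : (k : ℝ) ≠ 0 := by exact_mod_cast hk
  set P : Matrix (Fin k) (Fin k) 𝕜 := ((n : ℝ) / k) • (Tᴴ * T) with hP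
  have hPP : P * P = P := by
    have : Tᴴ * T * (Tᴴ * T) = Tᴴ * (T * Tᴴ) * T := by simp only [Matrix.mul_assoc]
    rw [hP, Matrix.smul_mul, Matrix.mul_smul, this, hTT, Matrix.mul_smul, Matrix.smul_mul,
      Matrix.mul_one, smul_smul, smul_smul]
    congr 1
    field_simp
  have hPd : ∀ i, P i i = (n : 𝕜) / k := fun i => by
    rw [hP, Matrix.smul_apply, hdiagT, RCLike.real_smul_eq_coe_mul]
    simp
  -- Multiplied by the diagonal matrix, the Gram matrix becomes `T* Z T`, which is self-adjoint;
  -- taking adjoints gives the commutation.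
  have hcomm : Tᴴ * T * realDiagonalMatrix 𝕜 z =
      realDiagonalMatrix 𝕜 z * (Tᴴ * T) := by
    have e1 : Tᴴ * T * realDiagonalMatrix 𝕜 z = Tᴴ * Z * T := by
      rw [Matrix.mul_assoc, ← hZT, Matrix.mul_assoc]
    have e2 := congrArg Matrix.conjTranspose e1
    rw [Matrix.conjTranspose_mul, Matrix.conjTranspose_mul, Matrix.conjTranspose_mul,
      Matrix.conjTranspose_mul, Matrix.conjTranspose_conjTranspose, hZH,
      conjTranspose_realDiagonalMatrix, ← Matrix.mul_assoc] at e2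
    rw [e1, ← Matrix.mul_assoc, e2, Matrix.mul_assoc]
  have hconst := eq_of_commute_realDiagonalMatrix hcop hPP hPd (z := z) (by
    rw [hP, Matrix.smul_mul, Matrix.mul_smul, hcomm])
  set i₀ : Fin k := ⟨0, Nat.pos_of_ne_zero hk⟩
  have hD : realDiagonalMatrix 𝕜 z =
      (z i₀) • (1 : Matrix (Fin k) (Fin k) 𝕜) := by
    rw [realDiagonalMatrix_apply]
    ext i j
    by_cases hij : i = j
    · subst hij; simp [hconst i i₀, RCLike.real_smul_eq_coe_mul]
    · simp [hij]
  rw [hD, Matrix.mul_smul, Matrix.mul_one] at hZT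
  have e3 := congrArg (fun A => A * Tᴴ) hZT
  simp only [Matrix.mul_assoc, Matrix.smul_mul, hTT, Matrix.mul_smul, Matrix.mul_one] at e3
  have hkn : (k : ℝ) / n ≠ 0 := div_ne_zero hkR hn
  rw [smul_comm] at e3
  have e4 : Z = z i₀ • 1 := smul_right_injective _ hkn e3
  rw [e4, Matrix.trace_smul, RCLike.smul_re, Matrix.trace_one, Fintype.card_fin,
    RCLike.natCast_re] at hZt
  have e5 : z i₀ = 0 := by simpa [hn] using hZt
  rw [e4, e5, zero_smul]

/-- The differential of the frame defect at a spherical tight frame maps the tuples of tangent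
vectors of the sphere onto the traceless self-adjoint matrices. -/
theorem exists_tangent_fderiv_frameDefect_eq [NeZero n] (hk : k ≠ 0) (hcop : Nat.Coprime n k)
    {F : Fin k → EuclideanSpace 𝕜 (Fin n)} (hF : ∀ i, ‖F i‖ = 1) (h : IsTightFrame 𝕜 F)
    (w : tracelessHermitian 𝕜 n) :
    ∃ v : Fin k → EuclideanSpace 𝕜 (Fin n), (∀ i, RCLike.re (inner 𝕜 (F i) (v i)) = 0) ∧
      fderiv ℝ (frameDefect 𝕜 k n) F v = w := by
  have hn : (n : ℝ) ≠ 0 := by exact_mod_cast NeZero.ne n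
  have hkR : (k : ℝ) ≠ 0 := by exact_mod_cast hk
  set T := columnMatrix 𝕜 k n F with hT
  have hTT : T * Tᴴ = ((k : ℝ) / n) • (1 : Matrix (Fin n) (Fin n) 𝕜) :=
    columnMatrix_mul_conjTranspose_of_isTightFrame hF h
  have hdiagT : ∀ i, (Tᴴ * T) i i = 1 := fun i => by
    rw [hT, conjTranspose_mul_columnMatrix_apply, inner_self_eq_norm_sq_to_K, hF]; simp
  -- The numbers `⟨f_i, Z f_i⟩`; subtracting these multiples of `f_i` from `Z f_i` projects it to
  -- the tangent space of the sphere.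
  set lam : Matrix (Fin n) (Fin n) 𝕜 → Fin k → ℝ :=
    fun Z => realDiagonalLinear 𝕜 k (Tᴴ * Z * T) with hlam
  set U : tracelessHermitian 𝕜 n →ₗ[ℝ] Matrix (Fin n) (Fin k) 𝕜 :=
    { toFun := fun Z => (Z : Matrix (Fin n) (Fin n) 𝕜) * T - T * realDiagonalMatrix 𝕜 (lam Z)
      map_add' := fun Y Z => by
        simp only [hlam, Submodule.coe_add, Matrix.add_mul, Matrix.mul_add, map_add]
        abel
      map_smul' := fun c Z => by
        simp only [hlam, Submodule.coe_smul, Matrix.smul_mul, Matrix.mul_smul, map_smul,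
          RingHom.id_apply, smul_sub] } with hU
  have hUa : ∀ Z : tracelessHermitian 𝕜 n, U Z =
    (Z : Matrix (Fin n) (Fin n) 𝕜) * T - T * realDiagonalMatrix 𝕜 (lam Z) := fun Z => rfl
  have htan : ∀ Z, realDiagonalLinear 𝕜 k (Tᴴ * U Z) = 0 := by
    intro Z
    rw [hUa, Matrix.mul_sub, map_sub, ← Matrix.mul_assoc, ← Matrix.mul_assoc, sub_eq_zero]
    ext i
    rw [realDiagonalLinear_apply (Tᴴ * T * _), realDiagonalMatrix_apply, Matrix.mul_diagonal,
      hdiagT, one_mul, RCLike.ofReal_re]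
  set S : tracelessHermitian 𝕜 n →ₗ[ℝ] tracelessHermitian 𝕜 n :=
    { toFun := fun Z => tracelessPart 𝕜 n (U Z * Tᴴ + T * (U Z)ᴴ)
      map_add' := fun Y Z => by
        rw [← map_add]
        congr 1
        rw [map_add, Matrix.add_mul, Matrix.conjTranspose_add, Matrix.mul_add]; abel
      map_smul' := fun c Z => by
        rw [RingHom.id_apply, ← map_smul]
        congr 1
        rw [map_smul, Matrix.conjTranspose_smul, Matrix.smul_mul, Matrix.mul_smul, star_trivial,
          smul_add] } with hS
  have hSa : ∀ Z, S Z = tracelessPart 𝕜 n (U Z * Tᴴ + T * (U Z)ᴴ) := fun Z => rfl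
  have hinj : Function.Injective S := by
    rw [← LinearMap.ker_eq_bot, LinearMap.ker_eq_bot']
    intro Z hZ
    have hZH : (Z : Matrix (Fin n) (Fin n) 𝕜)ᴴ = Z := Z.2.1
    have hZt : RCLike.re (Z : Matrix (Fin n) (Fin n) 𝕜).trace = 0 := Z.2.2
    have hsum : (U Z * Tᴴ + T * (U Z)ᴴ)ᴴ = U Z * Tᴴ + T * (U Z)ᴴ := by
      rw [Matrix.conjTranspose_add, Matrix.conjTranspose_mul, Matrix.conjTranspose_mul,
        Matrix.conjTranspose_conjTranspose, Matrix.conjTranspose_conjTranspose, add_comm]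
    have h0 : (U Z * Tᴴ + T * (U Z)ᴴ) =
        ((n : ℝ)⁻¹ * RCLike.re (U Z * Tᴴ + T * (U Z)ᴴ).trace) • 1 := by
      rw [← sub_eq_zero, ← coe_tracelessPart hsum, ← hSa, hZ]; rfl
    have hUZ := eq_zero_of_tangent_of_mul_conjTranspose_eq_smul hZH hZt (hUa Z) (htan Z) h0
    rw [hUa, sub_eq_zero] at hUZ
    exact Subtype.ext (eq_zero_of_mul_eq_mul_diagonal hk hcop hTT hdiagT hZH hZt hUZ)
  obtain ⟨Z, hZ⟩ := LinearMap.surjective_of_injective hinj w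
  obtain ⟨v, hv⟩ := columnMatrix_surjective (U Z)
  refine ⟨v, fun i => ?_, ?_⟩
  · rw [← conjTranspose_mul_columnMatrix_apply, hv, ← realDiagonalLinear_apply, htan]; rfl
  · rw [fderiv_frameDefect, hv, ← hT, ← hZ, hSa]

theorem isRegularAnalyticSubmanifold_sphericalTightFrames_real [NeZero n] (hk : k ≠ 0)
    (hcop : Nat.Coprime n k) {d : ℕ}
    (hd : k * (n - 1) = d + Module.finrank ℝ (tracelessHermitian ℝ n)) :
    IsRegularAnalyticSubmanifold (powerModel k (n - 1)) (sphericalTightFrames ℝ k n) d := by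
  refine isRegularAnalyticSubmanifold_sphere_pow (G := frameDefect ℝ k n) contDiff_frameDefect
    (fun F => isTightFrame_iff_tracelessPart_eq_zero hk fun i => by simp) (fun F hF w => ?_) hd
  obtain ⟨v, hv, hvw⟩ := exists_tangent_fderiv_frameDefect_eq hk hcop (fun i => by simp) hF w
  exact ⟨v, hv, hvw⟩

theorem isRegularAnalyticSubmanifold_sphericalTightFrames_complex [NeZero n] (hk : k ≠ 0)
    (hcop : Nat.Coprime n k) {d : ℕ}
    (hd : k * (2 * n - 1) = d + Module.finrank ℝ (tracelessHermitian ℂ n)) :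
    IsRegularAnalyticSubmanifold (powerModel k (2 * n - 1)) (sphericalTightFrames ℂ k n) d := by
  refine isRegularAnalyticSubmanifold_sphere_pow (G := frameDefect ℂ k n) contDiff_frameDefect
    (fun F => isTightFrame_iff_tracelessPart_eq_zero hk fun i => by simp) (fun F hF w => ?_) hd
  obtain ⟨v, hv, hvw⟩ := exists_tangent_fderiv_frameDefect_eq hk hcop (fun i => by simp) hF w
  -- Tangency to the real sphere uses the real inner product, which is the real part of the
  -- Hermitian one.
  refine ⟨v, fun i => ?_, hvw⟩
  have h := hv i
  rw [PiLp.inner_apply, map_sum] at h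
  rw [PiLp.inner_apply, ← h]
  refine Finset.sum_congr rfl fun a _ => ?_
  rw [Complex.inner, RCLike.inner_apply, mul_comm]
  rfl

end Frames

/-! ### Existence of projections and frames -/

section Existence

variable {𝕜 : Type*} [RCLike 𝕜] {k n : ℕ}

/-- The interval `[-m, m]` with `2m < k` has distinct residues mod `k`; drop `0` when `n` is even.
Symmetry will make the Fourier projection real. -/
theorem exists_symmetric_frequencies (hkn : n < k) :
    ∃ J : Finset ℤ, J.card = n ∧ (∀ j, j ∈ J → -j ∈ J) ∧
      ∀ i ∈ J, ∀ j ∈ J, (k : ℤ) ∣ i - j → i = j := by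
  have key : ∀ (m : ℕ), 2 * m < k → ∀ J : Finset ℤ, J ⊆ Finset.Icc (-(m : ℤ)) m →
      ∀ i ∈ J, ∀ j ∈ J, (k : ℤ) ∣ i - j → i = j := by
    intro m hm J hJ i hi j hj hd
    have h1 := Finset.mem_Icc.1 (hJ hi)
    have h2 := Finset.mem_Icc.1 (hJ hj)
    have h3 := Int.eq_zero_of_abs_lt_dvd hd (by rw [abs_lt]; constructor <;> omega)
    omega
  rcases Nat.even_or_odd' n with ⟨m, rfl | rfl⟩
  · refine ⟨(Finset.Icc (-(m : ℤ)) m).erase 0, ?_, ?_, key m hkn _ (Finset.erase_subset _ _)⟩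
    · rw [Finset.card_erase_of_mem (by simp), Int.card_Icc]
      omega
    · intro j hj
      simp only [Finset.mem_erase, Finset.mem_Icc] at hj ⊢
      omega
  · refine ⟨Finset.Icc (-(m : ℤ)) m, ?_, ?_, key m (by omega) _ subset_rfl⟩
    · rw [Int.card_Icc]
      omega
    · intro j hj
      simp only [Finset.mem_Icc] at hj ⊢
      omega

theorem sum_zpow_mul_eq_zero {ζ : ℂ} (hζ : IsPrimitiveRoot ζ k) {d : ℤ} (hd : ¬ (k : ℤ) ∣ d) :
    ∑ b : Fin k, ζ ^ (d * (b : ℤ)) = 0 := by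
  have h1 : ζ ^ d ≠ 1 := fun h => hd ((hζ.zpow_eq_one_iff_dvd d).1 h)
  have h2 : ∀ b : Fin k, ζ ^ (d * (b : ℤ)) = (ζ ^ d) ^ (b : ℕ) := fun b => by
    rw [zpow_mul, zpow_natCast]
  rw [Finset.sum_congr rfl fun b _ => h2 b, Fin.sum_univ_eq_sum_range (fun b => (ζ ^ d) ^ b),
    geom_sum_eq h1, ← zpow_natCast, ← zpow_mul, mul_comm, zpow_mul, zpow_natCast, hζ.pow_eq_one,
    one_zpow, sub_self, zero_div]

/-- A circulant projection with real entries and constant diagonal. -/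
theorem exists_real_projection (hkn : n < k) :
    ∃ P : Matrix (Fin k) (Fin k) ℝ, Pᵀ = P ∧ P * P = P ∧ ∀ i, P i i = (n : ℝ) / k := by
  have hk : k ≠ 0 := by omega
  have hkC : (k : ℂ) ≠ 0 := by exact_mod_cast hk
  obtain ⟨J, hJn, hJs, hJ⟩ := exists_symmetric_frequencies hkn
  obtain ⟨ζ, hζ⟩ : ∃ ζ : ℂ, IsPrimitiveRoot ζ k := ⟨_, Complex.isPrimitiveRoot_exp k hk⟩
  have hζ0 : ζ ≠ 0 := hζ.ne_zero hk
  -- The orthogonal projection onto the span of the characters `a ↦ ζ ^ (j a)` with `j ∈ J`.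
  set C : Matrix (Fin k) (Fin k) ℂ :=
    Matrix.of fun a b => (k : ℂ)⁻¹ * ∑ j ∈ J, ζ ^ (j * ((a : ℤ) - b)) with hC
  have hCa : ∀ a b, C a b = (k : ℂ)⁻¹ * ∑ j ∈ J, ζ ^ (j * ((a : ℤ) - b)) := fun a b => rfl
  have hsymm : ∀ x : ℤ, ∑ j ∈ J, ζ ^ (j * -x) = ∑ j ∈ J, ζ ^ (j * x) := fun x => by
    refine Finset.sum_bij' (fun j _ => -j) (fun j _ => -j) (fun j hj => hJs j hj)
      (fun j hj => hJs j hj) (by simp) (by simp) (fun j _ => ?_)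
    congr 1; ring
  have hCt : ∀ a b, C b a = C a b := fun a b => by
    rw [hCa, hCa, ← hsymm ((a : ℤ) - b)]
    congr 1
    refine Finset.sum_congr rfl fun j _ => ?_
    congr 1; ring
  have hconj : (starRingEnd ℂ) ζ = ζ⁻¹ := by
    rw [Complex.inv_def, Complex.normSq_eq_norm_sq,
      Complex.norm_eq_one_of_pow_eq_one hζ.pow_eq_one hk]
    simp
  have hCr : ∀ a b, (starRingEnd ℂ) (C a b) = C a b := fun a b => by
    rw [hCa, map_mul, map_inv₀, map_natCast, map_sum, ← hsymm]
    congr 1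
    refine Finset.sum_congr rfl fun j _ => ?_
    rw [map_zpow₀, hconj, inv_zpow', mul_neg]
  have hCC : C * C = C := by
    ext a c
    rw [Matrix.mul_apply]
    have h1 : ∀ b : Fin k, C a b * C b c = (k : ℂ)⁻¹ * (k : ℂ)⁻¹ *
        ∑ i ∈ J, ∑ j ∈ J, ζ ^ (i * (a : ℤ) - j * c) * ζ ^ ((j - i) * (b : ℤ)) := by
      intro b
      rw [hCa, hCa, mul_mul_mul_comm, Finset.sum_mul_sum]
      congr 1
      refine Finset.sum_congr rfl fun i _ => Finset.sum_congr rfl fun j _ => ?_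
      rw [← zpow_add₀ hζ0, ← zpow_add₀ hζ0]
      congr 1; ring
    rw [Finset.sum_congr rfl fun b _ => h1 b, ← Finset.mul_sum, Finset.sum_comm]
    have h2 : ∀ i ∈ J, ∑ b : Fin k, ∑ j ∈ J, ζ ^ (i * (a : ℤ) - j * c) * ζ ^ ((j - i) * (b : ℤ)) =
        k * ζ ^ (i * ((a : ℤ) - c)) := by
      intro i hi
      rw [Finset.sum_comm, Finset.sum_eq_single i]
      · simp [mul_sub]
      · intro j hj hji
        rw [← Finset.mul_sum, sum_zpow_mul_eq_zero hζ (fun h => hji (hJ j hj i hi h)), mul_zero]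
      · exact fun h => absurd hi h
    rw [Finset.sum_congr rfl h2, ← Finset.mul_sum, hCa, ← mul_assoc, mul_assoc (k : ℂ)⁻¹,
      inv_mul_cancel₀ hkC, mul_one]
  have hCre : ∀ a b, ((C a b).re : ℂ) = C a b := fun a b => Complex.conj_eq_iff_re.1 (hCr a b)
  refine ⟨Matrix.of fun a b => (C a b).re, ?_, ?_, ?_⟩
  · ext a b
    simp [hCt a b]
  · ext a c
    have h := congrFun (congrFun hCC a) c
    rw [Matrix.mul_apply] at h
    apply Complex.ofReal_injective
    rw [Matrix.mul_apply]
    push_cast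
    simp only [Matrix.of_apply, hCre]
    exact h
  · intro i
    apply Complex.ofReal_injective
    rw [Matrix.of_apply, hCre, hCa]
    simp [hJn, div_eq_inv_mul]

theorem exists_projection (𝕜 : Type*) [RCLike 𝕜] (hkn : n < k) :
    ∃ P : Matrix (Fin k) (Fin k) 𝕜, Pᴴ = P ∧ P * P = P ∧ P.rank = n ∧
      ∀ i, P i i = (n : 𝕜) / k := by
  obtain ⟨Q, hQt, hQQ, hQd⟩ := exists_real_projection hkn
  have hPP : Q.map (algebraMap ℝ 𝕜) * Q.map (algebraMap ℝ 𝕜) = Q.map (algebraMap ℝ 𝕜) := by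
    rw [← Matrix.map_mul, hQQ]
  have hPd : ∀ i, Q.map (algebraMap ℝ 𝕜) i i = (n : 𝕜) / k := fun i => by
    rw [Matrix.map_apply, hQd]; simp
  refine ⟨Q.map (algebraMap ℝ 𝕜), ?_, hPP, ?_, hPd⟩
  · ext i j
    have h : Q j i = Q i j := congrFun (congrFun hQt i) j
    simp [Matrix.conjTranspose_apply, h]
  · have h := trace_eq_rank_of_idempotent hPP
    have hk : (k : 𝕜) ≠ 0 := by
      have : k ≠ 0 := by omega
      exact_mod_cast this
    simp only [Matrix.trace, Matrix.diag_apply, hPd, Finset.sum_const, Finset.card_univ,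
      Fintype.card_fin, nsmul_eq_mul] at h
    rw [mul_div_cancel₀ _ hk] at h
    exact_mod_cast h.symm

theorem frameGramSet_nonempty (hkn : n < k) : (frameGramSet 𝕜 k n).Nonempty := by
  obtain ⟨P, h1, h2, h3, h4⟩ := exists_projection 𝕜 hkn
  exact ⟨_, P, h1, h2, h3, h4, rfl⟩

/-- Project the standard basis by `P`, take orthonormal coordinates in its range, and scale by
`√(k/n)`. The squared norm of `P e_i` is `P i i = n/k`, so these are unit vectors, and Parseval
gives tightness. -/
theorem sphericalTightFrames_nonempty [NeZero n] (hkn : n < k) :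
    (sphericalTightFrames 𝕜 k n).Nonempty := by
  have hk : k ≠ 0 := by omega
  have hn : n ≠ 0 := NeZero.ne n
  have hkR : (0 : ℝ) < k := by positivity
  have hnR : (0 : ℝ) < n := by positivity
  obtain ⟨P, hPH, hPP, hrank, hdiag⟩ := exists_projection 𝕜 hkn
  set A := Matrix.toEuclideanLin P with hA
  have hsymm : A.IsSymmetric := Matrix.isSymmetric_toEuclideanLin_iff.2 hPH
  have hAA : ∀ x, A (A x) = A x := fun x => by
    rw [hA, ← LinearMap.comp_apply, ← Matrix.toLpLin_mul_same, hPP]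
  have hfin : Module.finrank 𝕜 (LinearMap.range A) = n := by
    rw [← hrank, Matrix.rank_eq_finrank_range_toLin P
      (EuclideanSpace.basisFun (Fin k) 𝕜).toBasis (EuclideanSpace.basisFun (Fin k) 𝕜).toBasis,
      hA, Matrix.toEuclideanLin_eq_toLin_orthonormal]
  set b := (stdOrthonormalBasis 𝕜 (LinearMap.range A)).reindex (finCongr hfin)
  set e : Fin k → EuclideanSpace 𝕜 (Fin k) := fun i => EuclideanSpace.single i 1 with he
  set y : Fin k → LinearMap.range A := fun i => ⟨A (e i), LinearMap.mem_range_self A _⟩ with hy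
  set f : Fin k → EuclideanSpace 𝕜 (Fin n) := fun i => ((√(k / n) : ℝ) : 𝕜) • b.repr (y i) with hf
  have hsq : √((k : ℝ) / n) ^ 2 = k / n := Real.sq_sqrt (by positivity)
  have hynorm : ∀ i, ‖y i‖ ^ 2 = (n : ℝ) / k := by
    intro i
    have h1 : inner 𝕜 (A (e i)) (A (e i)) = (n : 𝕜) / k := by
      rw [hsymm, hAA, he, EuclideanSpace.inner_single_left, hA, Matrix.toLpLin_apply, ← hdiag i]
      simp
    rw [inner_self_eq_norm_sq_to_K] at h1
    have h2 : ‖A (e i)‖ ^ 2 = (n : ℝ) / k := by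
      apply RCLike.ofReal_injective (K := 𝕜)
      push_cast
      exact h1
    exact h2
  have hfnorm : ∀ i, ‖f i‖ = 1 := by
    intro i
    have h1 : ‖f i‖ ^ 2 = 1 := by
      rw [hf, norm_smul, mul_pow, LinearIsometryEquiv.norm_map, hynorm, RCLike.norm_ofReal,
        sq_abs, hsq]
      field_simp
    exact (pow_eq_one_iff_of_nonneg (norm_nonneg _) two_ne_zero).1 h1
  refine ⟨fun i => ⟨f i, by simp [hfnorm]⟩, k / n, by positivity, fun v => ?_⟩
  obtain ⟨x, hx⟩ := (b.repr.symm v).2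
  have hw : A (b.repr.symm v) = (b.repr.symm v : EuclideanSpace 𝕜 (Fin k)) := by
    rw [← hx, hAA]
  have h1 : ∀ i, ‖inner 𝕜 v (f i)‖ ^ 2 =
      (k : ℝ) / n * ‖inner 𝕜 (b.repr.symm v : EuclideanSpace 𝕜 (Fin k)) (e i)‖ ^ 2 := by
    intro i
    have h2 : inner 𝕜 v (b.repr (y i)) =
        inner 𝕜 (b.repr.symm v : EuclideanSpace 𝕜 (Fin k)) (e i) := by
      rw [← b.repr.apply_symm_apply v, LinearIsometryEquiv.inner_map_map,
        LinearIsometryEquiv.apply_symm_apply, Submodule.coe_inner]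
      change inner 𝕜 (b.repr.symm v : EuclideanSpace 𝕜 (Fin k)) (A (e i)) = _
      rw [← hsymm, hw]
    rw [hf, inner_smul_right, norm_mul, mul_pow, h2, RCLike.norm_ofReal, sq_abs, hsq]
  have h3 := (EuclideanSpace.basisFun (Fin k) 𝕜).sum_sq_norm_inner_left
    (b.repr.symm v : EuclideanSpace 𝕜 (Fin k))
  simp only [EuclideanSpace.basisFun_apply] at h3
  simp only [h1]
  rw [← Finset.mul_sum, h3]
  congr 2
  exact b.repr.symm.norm_map v

end Existence

/-! ### One-parameter groups of matrices -/

section MatrixExponential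

variable {𝕜 : Type*} [RCLike 𝕜] {k n : ℕ}

section OperatorNorm

attribute [-instance] Matrix.seminormedAddCommGroup Matrix.normedAddCommGroup Matrix.normedSpace

attribute [local instance] Matrix.linftyOpNormedRing Matrix.linftyOpNormedAlgebra

theorem contDiff_exp_smul_apply (X : Matrix (Fin k) (Fin k) 𝕜) (i j : Fin k) :
    ContDiff ℝ ω fun t : ℝ => NormedSpace.exp (t • X) i j := by
  have h1 : ContDiff ℝ ω fun t : ℝ => NormedSpace.exp (t • X) := by
    refine contDiff_iff_contDiffAt.2 fun t => AnalyticAt.contDiffAt ?_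
    have h2 : AnalyticAt ℝ (fun t : ℝ => t • X) t :=
      analyticAt_id.smul analyticAt_const
    exact AnalyticAt.comp (g := NormedSpace.exp) (f := fun t : ℝ => t • X)
      (NormedSpace.exp_analytic (𝕂 := ℝ) (t • X)) h2
  exact (LinearMap.toContinuousLinearMap (Matrix.entryLinearMap ℝ 𝕜 i j)).contDiff.comp h1

theorem hasDerivAt_exp_smul_apply (X : Matrix (Fin k) (Fin k) 𝕜) (i j : Fin k) :
    HasDerivAt (fun t : ℝ => NormedSpace.exp (t • X) i j) (X i j) 0 := by
  have h1 : HasDerivAt (fun t : ℝ => NormedSpace.exp (t • X)) X 0 := by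
    have h2 := hasDerivAt_exp_smul_const (𝕂 := ℝ) X (0 : ℝ)
    rw [zero_smul, NormedSpace.exp_zero, one_mul] at h2
    exact h2
  exact (LinearMap.toContinuousLinearMap
    (Matrix.entryLinearMap ℝ 𝕜 i j)).hasFDerivAt.comp_hasDerivAt 0 h1

end OperatorNorm

theorem contDiff_exp_smul (X : Matrix (Fin k) (Fin k) 𝕜) :
    ContDiff ℝ ω fun t : ℝ => NormedSpace.exp (t • X) :=
  contDiff_pi.2 fun i => contDiff_pi.2 fun j => contDiff_exp_smul_apply X i j

theorem hasDerivAt_exp_smul (X : Matrix (Fin k) (Fin k) 𝕜) :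
    HasDerivAt (fun t : ℝ => NormedSpace.exp (t • X)) X 0 :=
  hasDerivAt_pi.2 fun i => hasDerivAt_pi.2 fun j => hasDerivAt_exp_smul_apply X i j

theorem hasDerivAt_matrix_mul {l m o : Type*} [Fintype l] [Fintype m] [Fintype o]
    {f : ℝ → Matrix l m 𝕜} {g : ℝ → Matrix m o 𝕜} {f' : Matrix l m 𝕜} {g' : Matrix m o 𝕜} {x : ℝ}
    (hf : HasDerivAt f f' x) (hg : HasDerivAt g g' x) :
    HasDerivAt (fun x => f x * g x) (f' * g x + f x * g') x := by
  refine hasFDerivAt_matrix_mul hf.hasFDerivAt hg.hasFDerivAt fun v => ?_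
  simp [ContinuousLinearMap.toSpanSingleton_apply, smul_add]

end MatrixExponential

/-! ### Tangent vectors of the Grassmannian and the regular value -/

section Grassmannian

variable {𝕜 : Type*} [RCLike 𝕜] {k n : ℕ}

theorem isHermitian_of_mem_grassmannian {P : Matrix (Fin k) (Fin k) 𝕜}
    (hP : P ∈ grassmannian 𝕜 k n) : Pᴴ = P := by
  obtain ⟨V, -, rfl⟩ := hP
  rw [Matrix.conjTranspose_mul, Matrix.conjTranspose_mul, Matrix.conjTranspose_conjTranspose,
    Matrix.diagonal_conjTranspose, Matrix.mul_assoc]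
  congr 3
  funext i
  simp only [Pi.star_apply]
  split_ifs <;> simp

theorem mul_self_of_mem_grassmannian {P : Matrix (Fin k) (Fin k) 𝕜}
    (hP : P ∈ grassmannian 𝕜 k n) : P * P = P := by
  obtain ⟨V, hV, rfl⟩ := hP
  have hVV : V * Vᴴ = 1 := Matrix.mem_unitaryGroup_iff.1 hV
  set D := Matrix.diagonal (fun i : Fin k => if (i : ℕ) < n then (1 : 𝕜) else 0) with hD
  have hDD : D * D = D := by
    rw [hD, Matrix.diagonal_mul_diagonal]
    congr 1
    funext i
    split_ifs <;> simp
  have : Vᴴ * D * V * (Vᴴ * D * V) = Vᴴ * D * (V * Vᴴ) * D * V := by simp only [Matrix.mul_assoc]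
  rw [this, hVV, Matrix.mul_one, Matrix.mul_assoc Vᴴ D D, hDD]

theorem conj_mem_grassmannian {P U : Matrix (Fin k) (Fin k) 𝕜} (hP : P ∈ grassmannian 𝕜 k n)
    (hU : U * Uᴴ = 1) : Uᴴ * P * U ∈ grassmannian 𝕜 k n := by
  obtain ⟨V, hV, rfl⟩ := hP
  refine ⟨V * U, Matrix.mem_unitaryGroup_iff.2 ?_, ?_⟩
  · have hVV : V * Vᴴ = 1 := Matrix.mem_unitaryGroup_iff.1 hV
    rw [Matrix.star_eq_conjTranspose, Matrix.conjTranspose_mul, Matrix.mul_assoc,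
      ← Matrix.mul_assoc U, hU, Matrix.one_mul, hVV]
  · rw [Matrix.conjTranspose_mul]
    simp only [Matrix.mul_assoc]

/-- Commutators with skew-adjoint matrices are tangent to the Grassmannian. -/
theorem commutator_mem_tangentVectors {P X : Matrix (Fin k) (Fin k) 𝕜}
    (hP : P ∈ grassmannian 𝕜 k n) (hX : Xᴴ = -X) :
    X * P - P * X ∈ tangentVectors (grassmannian 𝕜 k n) P := by
  have hstar : ∀ t : ℝ, (NormedSpace.exp (t • -X))ᴴ = NormedSpace.exp (t • X) := fun t => by
    rw [← Matrix.exp_conjTranspose, Matrix.conjTranspose_smul, Matrix.conjTranspose_neg, hX,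
      neg_neg, star_trivial]
  -- Exponentials of skew-adjoint matrices are unitary, so this curve stays in the orbit; its
  -- velocity is the commutator.
  refine ⟨fun t => NormedSpace.exp (t • X) * P * NormedSpace.exp (t • -X), ?_, ?_, ?_, ?_⟩
  · exact (contDiff_matrix_mul (contDiff_matrix_mul (contDiff_exp_smul X) contDiff_const)
      (contDiff_exp_smul (-X))).contDiffAt.analyticAt
  · simp
  · refine Filter.Eventually.of_forall fun t => ?_
    change NormedSpace.exp (t • X) * P * NormedSpace.exp (t • -X) ∈ _
    rw [← hstar t]
    refine conj_mem_grassmannian hP ?_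
    rw [hstar, smul_neg, Matrix.exp_neg]
    exact Matrix.nonsing_inv_mul _ ((Matrix.isUnit_iff_isUnit_det _).1 (Matrix.isUnit_exp _))
  · have h := hasDerivAt_matrix_mul (hasDerivAt_matrix_mul (hasDerivAt_exp_smul X)
      (hasDerivAt_const (0 : ℝ) P)) (hasDerivAt_exp_smul (-X))
    refine h.congr_deriv ?_
    simp [sub_eq_add_neg]

theorem sum_eq_zero_of_mem_tangentVectors_diagonalHyperplane {c w : Fin k → ℝ}
    (hw : w ∈ tangentVectors (diagonalHyperplane k n) c) : ∑ i, w i = 0 := by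
  obtain ⟨γ, -, -, hγ, hd⟩ := hw
  have h1 : HasDerivAt (fun t => ∑ i, γ t i) (∑ i, w i) 0 :=
    HasDerivAt.fun_sum fun i _ => hasDerivAt_pi.1 hd i
  have h2 : (fun t => ∑ i, γ t i) =ᶠ[nhds 0] fun _ => (n : ℝ) := hγ
  exact (h1.congr_of_eventuallyEq h2.symm).unique (hasDerivAt_const _ _)

theorem isRegularValueBetween_realDiagonal (hcop : Nat.Coprime n k) :
    IsRegularValueBetween (realDiagonal 𝕜 k) (grassmannian 𝕜 k n) (diagonalHyperplane k n)
      (fun _ => (n : ℝ) / k) := by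
  intro P hP hPd w hw
  have hPH := isHermitian_of_mem_grassmannian hP
  have hdiag : ∀ i, P i i = (n : 𝕜) / k := fun i => by
    have h1 : star (P i i) = P i i := congrFun (congrFun hPH i) i
    rw [← RCLike.conj_eq_iff_re.1 h1]
    have h2 : RCLike.re (P i i) = (n : ℝ) / k := congrFun hPd i
    rw [h2]
    simp
  obtain ⟨Z, hZ, hZw⟩ := exists_skew_realDiagonal_commutator hcop hPH
    (mul_self_of_mem_grassmannian hP) hdiag
  refine ⟨_, commutator_mem_tangentVectors hP (hZ w), ?_⟩
  have h : HasFDerivAt (realDiagonal 𝕜 k)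
      (LinearMap.toContinuousLinearMap (realDiagonalLinear 𝕜 k)) P :=
    (LinearMap.toContinuousLinearMap (realDiagonalLinear 𝕜 k)).hasFDerivAt
  refine (DFunLike.congr_fun h.fderiv _).trans ?_
  exact hZw w (sum_eq_zero_of_mem_tangentVectors_diagonalHyperplane hw)

end Grassmannian

/-! ### Assembly and dimension count -/

theorem mainTheorem1 (k n : ℕ) [NeZero n] (hkn : n < k) (hcop : Nat.Coprime n k) :
    -- the set of projections, real case
    ((frameGramSet ℝ k n).Nonempty ∧
      ∃ d : ℕ, (d : ℝ) = ((k : ℝ) - n - 1) * ((n : ℝ) - 1) ∧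
        IsRegularAnalyticSubmanifoldOfSpace (frameGramSet ℝ k n) d) ∧
    -- the set of frames, real case
    ((sphericalTightFrames ℝ k n).Nonempty ∧
      ∃ d : ℕ, (d : ℝ) = ((k : ℝ) - n / 2 - 1) * ((n : ℝ) - 1) ∧
        IsRegularAnalyticSubmanifold (powerModel k (n - 1)) (sphericalTightFrames ℝ k n) d) ∧
    -- the set of projections, complex case
    ((frameGramSet ℂ k n).Nonempty ∧
      ∃ d : ℕ, (d : ℝ) = 2 * (n : ℝ) * ((k : ℝ) - n) - k + 1 ∧
        IsRegularAnalyticSubmanifoldOfSpace (frameGramSet ℂ k n) d) ∧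
    -- the set of frames, complex case
    ((sphericalTightFrames ℂ k n).Nonempty ∧
      ∃ d : ℕ, (d : ℝ) = 2 * (n : ℝ) * ((k : ℝ) - n) + (n : ℝ) ^ 2 - k + 1 ∧
        IsRegularAnalyticSubmanifold (powerModel k (2 * n - 1)) (sphericalTightFrames ℂ k n) d) ∧
    -- the constant diagonal is a regular value of the diagonal map on the Grassmannians
    IsRegularValueBetween (realDiagonal ℝ k) (grassmannian ℝ k n) (diagonalHyperplane k n)
      (fun _ => (n : ℝ) / k) ∧
    IsRegularValueBetween (realDiagonal ℂ k) (grassmannian ℂ k n) (diagonalHyperplane k n)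
      (fun _ => (n : ℝ) / k) := by
  have hk : k ≠ 0 := by omega
  have hn : 1 ≤ n := Nat.one_le_iff_ne_zero.2 (NeZero.ne n)
  -- Writing `n = m + 1` and `k = n + l + 1` removes most truncated subtractions from the dimension
  -- formulas.
  obtain ⟨l, rfl⟩ : ∃ l, k = n + l + 1 := ⟨k - n - 1, by omega⟩
  obtain ⟨m, rfl⟩ : ∃ m, n = m + 1 := ⟨n - 1, by omega⟩
  have hsub : m + 1 + l + 1 - (m + 1) = l + 1 := by omega
  have hreal := finrank_tracelessHermitian (𝕜 := ℝ) (n := m + 1)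
  have hreal' := finrank_hermitianSubmodule_real (n := m + 1)
  have hcomplex := finrank_tracelessHermitian (𝕜 := ℂ) (n := m + 1)
  rw [finrank_hermitianSubmodule_complex] at hcomplex
  set r := Module.finrank ℝ (tracelessHermitian ℝ (m + 1))
  set c := Module.finrank ℝ (tracelessHermitian ℂ (m + 1))
  rw [← hreal] at hreal'
  have hr : 2 * r = m * (m + 3) := by nlinarith
  have hc : c = m * (m + 2) := by nlinarith
  have hrle : r ≤ (m + 1 + l + 1) * m := by nlinarith
  have hcle : c ≤ (m + 1 + l + 1) * (2 * m + 1) := by nlinarith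
  refine ⟨⟨frameGramSet_nonempty hkn, l * m, ?_,
      isRegularAnalyticSubmanifold_frameGramSet hkn hcop ?_⟩,
    ⟨sphericalTightFrames_nonempty hkn, (m + 1 + l + 1) * m - r, ?_,
      isRegularAnalyticSubmanifold_sphericalTightFrames_real hk hcop ?_⟩,
    ⟨frameGramSet_nonempty hkn, 2 * ((m + 1) * (l + 1)) - (m + l + 1), ?_,
      isRegularAnalyticSubmanifold_frameGramSet hkn hcop ?_⟩,
    ⟨sphericalTightFrames_nonempty hkn, (m + 1 + l + 1) * (2 * m + 1) - c, ?_,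
      isRegularAnalyticSubmanifold_sphericalTightFrames_complex hk hcop ?_⟩,
    isRegularValueBetween_realDiagonal hcop, isRegularValueBetween_realDiagonal hcop⟩
  · push_cast
    ring
  · rw [hsub, Module.finrank_self, Nat.add_sub_cancel]
    ring
  · have hr' : (2 : ℝ) * r = m * (m + 3) := by exact_mod_cast hr
    rw [Nat.cast_sub hrle]
    push_cast
    linarith
  · rw [Nat.add_sub_cancel, Nat.sub_add_cancel hrle]
  · rw [Nat.cast_sub (by nlinarith)]
    push_cast
    ring
  · rw [hsub, Complex.finrank_real_complex, Nat.add_sub_cancel,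
      show m + 1 + l = m + l + 1 by ring, Nat.sub_add_cancel (by nlinarith)]
  · rw [Nat.cast_sub hcle, hc]
    push_cast
    ring
  · rw [show 2 * (m + 1) - 1 = 2 * m + 1 by omega, Nat.sub_add_cancel hcle]
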